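/- Let $M\in\mathbb R^{n\times m}$ with $n\ge m$, let $1\le r\le m$ and $d\le m$ be integers and $t\in\mathbb R$. Let $\sigma_1\ge\dots\ge\sigma_m\ge 0$ be the singular values of $M$ (with $\sigma_{m+1}=0$), let $M=U\Sigma V^\top$ be a singular value decomposition, and let $U_1\in\mathbb R^{n\times r}$, $V_1\in\mathbb R^{m\times r}$ consist of the first $r$ columns of $U$ and $V$. For matrices $X\in\mathbb R^{n\times r}$ and $Y\in\mathbb R^{m\times r}$ with rows $x_i$, $y_i$, put $$\mu(X,Y)=\max\Big(\max_{1\le i\le n}\tfrac nr|x_i|^2,\ \max_{1\le i\le m}\tfrac mr|y_i|^2\Big),\qquad \mu(r)=\mu(U_1,V_1).$$ Sample $d$ columns and, independently, $d$ rows of $M$ uniformly at random without replacement. Let $A\in\mathbb R^{n\times d}$ be the matrix of the sampled columns and let $B\in\mathbb R^{m\times d}$ be the matrix whose columns are the sampled rows. Let $\widehat U\in\mathbb R^{n\times r}$ and $\widehat V\in\mathbb R^{m\times r}$ consist of the first $r$ orthonormal eigenvectors (for the $r$ largest eigenvalues) of $AA^\top$ and $BB^\top$, where $\widehat U$ is determined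 by the sampled columns and $\widehat V$ by the sampled rows (ties between eigenvectors are broken in any such way), and let $\widehat\mu(r)=\mu(\widehat U,\widehat V)$. Then sample a set $\Omega\subseteq\{1,\dots,n\}\times\{1,\dots,m\}$ of entries uniformly at random among the sets of size $|\Omega|$; this size is fixed in advance or determined by the sampled columns and rows, and apart from it $\Omega$ is independent of them. Let $\mathcal R_\Omega$ be the operator that keeps the entries of a matrix with index in $\Omega$ and replaces the others by $0$, let $$Z_*\in\operatorname*{arg\,min}_{Z\in\mathbb R^{r\times r}}\tfrac12\big\|\mathcal R_\Omega(M)-\mathcal R_\Omega(\widehat U Z\widehat V^\top)\big\|_F^2,$$ and let $\widehat M=\widehat U Z_*\widehat V^\top$. Assume that $d\ge 7\mu(r)\,r\,(t+\ln r)$. Then with probability at least $1-3e^{-t}$ the following holds: if $|\Omega|\ge 7\widehat\mu(r)^2r^2(t+2\ln r)$, then, for every such minimizer $Z_*$, $$\|M-\widehat M\|_2^2\le 8\,\sigma_{r+1}^2\,(1+2mn)\Big(1+\frac{m+n}{d}\Big),$$ where $\|\cdot\|_2$ is the spectral norm. In particular, if the condition on $|\Omega|$ holds for every outcome of the sampled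 columns and rows, then the bound holds with probability at least $1-3e^{-t}$. -/

import Mathlib

namespace CURPlus

open Matrix

/-- Spectral norm (largest singular value) of a real matrix. -/
noncomputable def spectralNorm {n m : ℕ} (X : Matrix (Fin n) (Fin m) ℝ) : ℝ :=
  letI := Matrix.instL2OpNormedAddCommGroup (𝕜 := ℝ) (m := Fin n) (n := Fin m)
  ‖X‖

/-- Frobenius norm of a real matrix. -/
noncomputable def frobNorm {n m : ℕ} (X : Matrix (Fin n) (Fin m) ℝ) : ℝ :=
  letI := Matrix.frobeniusNormedAddCommGroup (m := Fin n) (n := Fin m) (α := ℝ)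
  ‖X‖

/-- The `k`-th largest singular value, counted from `k = 1` (and zero for `k` larger than the number
of columns). -/
noncomputable def sigma {n m : ℕ} (X : Matrix (Fin n) (Fin m) ℝ) (k : ℕ) : ℝ :=
  (Matrix.toEuclideanLin X).singularValues (k - 1)

/-- `M = U Σ Vᵀ` is a (thin) singular value decomposition of `M`: the columns of the `n × m` matrix
`U` and of the `m × m` matrix `V` are orthonormal, and `Σ` carries the singular values of `M` in
descending order. -/
def IsSVD {n m : ℕ} (M : Matrix (Fin n) (Fin m) ℝ) (U : Matrix (Fin n) (Fin m) ℝ)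
    (V : Matrix (Fin m) (Fin m) ℝ) : Prop :=
  Uᵀ * U = 1 ∧ Vᵀ * V = 1 ∧ M = U * diagonal (fun i : Fin m => sigma M (i.val + 1)) * Vᵀ

/-- The first `r` columns of a matrix. -/
def firstCols {p q r : ℕ} (hr : r ≤ q) (X : Matrix (Fin p) (Fin q) ℝ) :
    Matrix (Fin p) (Fin r) ℝ :=
  X.submatrix id (Fin.castLE hr)

/-- The incoherence `max (maxᵢ (n/r) |uᵢ|², maxᵢ (m/r) |vᵢ|²)`, where `uᵢ` and `vᵢ` are the rows of
`U` and `V`. -/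
noncomputable def incoherence {n m r : ℕ} (U : Matrix (Fin n) (Fin r) ℝ)
    (V : Matrix (Fin m) (Fin r) ℝ) : ℝ :=
  max (⨆ i : Fin n, (n : ℝ) / r * ∑ k, U i k ^ 2) (⨆ i : Fin m, (m : ℝ) / r * ∑ k, V i k ^ 2)

/-- The columns of `U` are first `r` eigenvectors of the symmetric matrix `S`: they are the first `r`
members of an orthonormal basis of eigenvectors (the columns of `W`) which is sorted by descending
eigenvalue. -/
def IsTopEigenvectors {p r : ℕ} (hr : r ≤ p) (S : Matrix (Fin p) (Fin p) ℝ)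
    (U : Matrix (Fin p) (Fin r) ℝ) : Prop :=
  ∃ (W : Matrix (Fin p) (Fin p) ℝ) (ev : Fin p → ℝ),
    Wᵀ * W = 1 ∧ Antitone ev ∧ S * W = W * diagonal ev ∧ U = firstCols hr W

/-- The matrix `A` whose columns are the columns of `M` with index in `J`. -/
def sampledCols {n m : ℕ} (M : Matrix (Fin n) (Fin m) ℝ) (J : Finset (Fin m)) :
    Matrix (Fin n) J ℝ :=
  M.submatrix id (fun j => j.val)

/-- The matrix `B` whose columns are the rows of `M` with index in `I`. -/
def sampledRows {n m : ℕ} (M : Matrix (Fin n) (Fin m) ℝ) (I : Finset (Fin n)) :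
    Matrix (Fin m) I ℝ :=
  (M.submatrix (fun i => i.val) id)ᵀ

/-- The operator that keeps the entries with index in `Om` and replaces the others by zero. -/
def restrict {n m : ℕ} (Om : Finset (Fin n × Fin m)) (X : Matrix (Fin n) (Fin m) ℝ) :
    Matrix (Fin n) (Fin m) ℝ :=
  Matrix.of fun i j => if (i, j) ∈ Om then X i j else 0

/-- The regression objective `½ ‖R_Ω(M) - R_Ω(U Z Vᵀ)‖_F²`. -/
noncomputable def objective {n m r : ℕ} (M : Matrix (Fin n) (Fin m) ℝ)
    (Om : Finset (Fin n × Fin m)) (U : Matrix (Fin n) (Fin r) ℝ) (V : Matrix (Fin m) (Fin r) ℝ)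
    (Z : Matrix (Fin r) (Fin r) ℝ) : ℝ :=
  1 / 2 * frobNorm (restrict Om M - restrict Om (U * Z * Vᵀ)) ^ 2

/-- `Mh = U Z Vᵀ` for some minimizer `Z` of the objective over all `r × r` matrices. -/
def IsCUREstimate {n m r : ℕ} (M : Matrix (Fin n) (Fin m) ℝ)
    (Om : Finset (Fin n × Fin m)) (U : Matrix (Fin n) (Fin r) ℝ) (V : Matrix (Fin m) (Fin r) ℝ)
    (Mh : Matrix (Fin n) (Fin m) ℝ) : Prop :=
  ∃ Z : Matrix (Fin r) (Fin r) ℝ,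
    (∀ Z' : Matrix (Fin r) (Fin r) ℝ, objective M Om U V Z ≤ objective M Om U V Z') ∧
      Mh = U * Z * Vᵀ

/-- The uniform distribution on the `k`-element subsets of a finite type (uniform sampling of `k`
elements without replacement). -/
noncomputable def uniformSubset (α : Type) [Fintype α] (k : ℕ) (hk : k ≤ Fintype.card α) :
    PMF (Finset α) :=
  PMF.uniformOfFinset (Finset.powersetCard k Finset.univ)
    (Finset.powersetCard_nonempty.mpr (by simpa using hk))

/-- The sampling scheme: a uniform set `J` of `d` columns and, independently, a uniform set `I` of
`d` rows; then, given `J` and `I`, a uniform set of `N J I` entries. -/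
noncomputable def sampling {n m d : ℕ} (hdm : d ≤ m) (hdn : d ≤ n)
    (N : Finset (Fin m) → Finset (Fin n) → ℕ) (hN : ∀ J I, N J I ≤ n * m) :
    PMF (Finset (Fin m) × Finset (Fin n) × Finset (Fin n × Fin m)) :=
  (uniformSubset (Fin m) d (by simpa using hdm)).bind fun J =>
    (uniformSubset (Fin n) d (by simpa using hdn)).bind fun I =>
      (uniformSubset (Fin n × Fin m) (N J I) (by simpa using hN J I)).map fun Om => (J, I, Om)

end CURPlus

namespace CURPlus

open Matrix NormedSpace

/-! One concentration estimate is used three times; everything else is deterministic linear algebra.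

Concentration: if vectors `v a` satisfy `∑ v a (v a)ᵀ = 1` and each has squared length at most `K /
|α|`, then a uniform `d`-subset `J` with `d ≥ 7 K (t + log dim)` satisfies `∑_J v vᵀ ≥ d / (2 |α|)`
outside probability `e^{-t}` (`card_ill_conditioned_le`). This is a matrix Chernoff bound:
Hoeffding's convexity comparison (`sum_powersetCard_le`) replaces sampling without replacement by
independent draws, and each draw contracts `tr exp` by a fixed factor. The contraction needs
Golden–Thompson only for a rank-one perturbation (`trace_exp_sub_rankOne`), obtained by cutting the
perturbation into infinitesimal steps. The systems `v` are the rows of `V₁`, the rows of `U₁`, and,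
once columns and rows are drawn, the tensors of rows of `Û` and `V̂`.

Linear algebra: write `σ` for `σ_{r+1}`. If the sampled rows of `V₁` are well conditioned, the top
eigenvectors of `A Aᵀ` miss little of the range of `M`: `‖(1 - Û Ûᵀ) M‖² ≤ σ² (1 + 8m/d)`
(`opSqLE_range_approximation`), and likewise for `V̂` with `n`. If the observed entries are well
conditioned, the least squares solution stays close to the projection `Ûᵀ M V̂`, at the cost of a
factor `1 + 2mn` (`opSqLE_estimate`). The three failure probabilities add up to at most `3 e^{-t}`.
-/

lemma isSymm_vecMulVec_self {ι : Type*} (v : ι → ℝ) : (vecMulVec v v).IsSymm := by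
  ext i j; simp [vecMulVec_apply, mul_comm]

lemma dotProduct_self_nonneg {ι : Type*} [Fintype ι] (v : ι → ℝ) : 0 ≤ v ⬝ᵥ v :=
  Finset.sum_nonneg fun i _ => mul_self_nonneg (v i)

/-- The logarithmic mean of `exp a` and `exp b` is at most their arithmetic mean. After division by
`exp b` this is monotonicity of `x/2 (eˣ + 1) - eˣ`, whose derivative is nonnegative because `e⁻ˣ ≥
1 - x`. -/
lemma exp_sub_exp_le_mean {a b : ℝ} (h : b ≤ a) :
    Real.exp a - Real.exp b ≤ (a - b) / 2 * (Real.exp a + Real.exp b) := by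
  have hd (x : ℝ) : HasDerivAt (fun x => x / 2 * (Real.exp x + 1) - Real.exp x)
      (1 / 2 * (Real.exp x + 1) + x / 2 * Real.exp x - Real.exp x) x :=
    (((hasDerivAt_id x).div_const 2).mul ((Real.hasDerivAt_exp x).add_const 1)).sub
      (Real.hasDerivAt_exp x)
  have hm : Monotone (fun x => x / 2 * (Real.exp x + 1) - Real.exp x) := by
    refine monotone_of_deriv_nonneg (fun x => (hd x).differentiableAt) fun x => ?_
    rw [(hd x).deriv]
    have h1 := mul_le_mul_of_nonneg_left (Real.add_one_le_exp (-x)) (Real.exp_nonneg x)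
    rw [← Real.exp_add, add_neg_cancel, Real.exp_zero] at h1
    nlinarith
  have h0 := hm (sub_nonneg.2 h)
  simp only [zero_div, zero_mul, Real.exp_zero] at h0
  have h2 : Real.exp a = Real.exp b * Real.exp (a - b) := by rw [← Real.exp_add]; ring_nf
  have h3 := mul_le_mul_of_nonneg_left h0 (Real.exp_nonneg b)
  rw [h2]
  nlinarith

/-! ### Trace exponentials under rank-one perturbations -/

section TraceExponential

variable {ι : Type*} [Fintype ι] [DecidableEq ι]

lemma IsSymm.exists_spectral {H : Matrix ι ι ℝ} (hH : H.IsSymm) :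
    ∃ (W : Matrix ι ι ℝ) (l : ι → ℝ), Wᵀ * W = 1 ∧ W * Wᵀ = 1 ∧ H = W * diagonal l * Wᵀ := by
  have hA : H.IsHermitian := by
    rw [Matrix.IsHermitian, conjTranspose_eq_transpose_of_trivial]; exact hH
  refine ⟨hA.eigenvectorUnitary, hA.eigenvalues, ?_, ?_, ?_⟩
  · have := Unitary.coe_star_mul_self hA.eigenvectorUnitary
    rwa [star_eq_conjTranspose, conjTranspose_eq_transpose_of_trivial] at this
  · have := Unitary.coe_mul_star_self hA.eigenvectorUnitary
    rwa [Unitary.coe_star, star_eq_conjTranspose, conjTranspose_eq_transpose_of_trivial] at this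
  · have h := hA.spectral_theorem
    rw [Unitary.conjStarAlgAut_apply] at h
    rw [star_eq_conjTranspose, conjTranspose_eq_transpose_of_trivial] at h
    exact h

lemma exp_spectral {W : Matrix ι ι ℝ} (l : ι → ℝ) (h : Wᵀ * W = 1) :
    exp (W * diagonal l * Wᵀ) = W * diagonal (fun i => Real.exp (l i)) * Wᵀ := by
  have hinv : W⁻¹ = Wᵀ := inv_eq_left_inv h
  have hu : IsUnit W := (isUnit_iff_isUnit_det W).2 (isUnit_det_of_left_inverse h)
  rw [← hinv, exp_conj W _ hu, exp_diagonal]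
  congr 3
  ext i
  rw [Pi.coe_exp, Real.exp_eq_exp_ℝ]

lemma trace_spectral {W : Matrix ι ι ℝ} (a : ι → ℝ) (h : Wᵀ * W = 1) :
    trace (W * diagonal a * Wᵀ) = ∑ i, a i := by
  rw [trace_mul_comm, ← Matrix.mul_assoc, h, Matrix.one_mul, trace_diagonal]

lemma trace_spectral_mul (W Z : Matrix ι ι ℝ) (a b : ι → ℝ) :
    trace ((Z * diagonal a * Zᵀ) * (W * diagonal b * Wᵀ)) =
      ∑ i, ∑ j, (Wᵀ * Z) i j ^ 2 * (b i * a j) := by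
  have : trace ((Z * diagonal a * Zᵀ) * (W * diagonal b * Wᵀ)) =
      trace ((diagonal b * (Wᵀ * Z)) * (diagonal a * (Wᵀ * Z)ᵀ)) := by
    rw [trace_mul_comm, transpose_mul, transpose_transpose]
    simp only [Matrix.mul_assoc]
    rw [trace_mul_comm]
    simp only [Matrix.mul_assoc]
  rw [this, trace]
  refine Finset.sum_congr rfl fun i _ => ?_
  rw [diag_apply, Matrix.mul_apply]
  refine Finset.sum_congr rfl fun j _ => ?_
  rw [diagonal_mul, diagonal_mul, transpose_apply]
  ring

lemma sum_sq_row {O : Matrix ι ι ℝ} (h : O * Oᵀ = 1) (i : ι) : ∑ j, O i j ^ 2 = 1 := by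
  have := congrFun (congrFun h i) i
  rw [Matrix.mul_apply, one_apply_eq] at this
  simpa [sq] using this

lemma quad_spectral (W : Matrix ι ι ℝ) (a : ι → ℝ) (v : ι → ℝ) :
    v ⬝ᵥ (W * diagonal a * Wᵀ) *ᵥ v = ∑ i, a i * (Wᵀ *ᵥ v) i ^ 2 := by
  rw [← mulVec_mulVec, ← mulVec_mulVec, dotProduct_mulVec, ← mulVec_transpose, dotProduct]
  refine Finset.sum_congr rfl fun i _ => ?_
  rw [mulVec_diagonal]; ring

/-- The gradient inequality for the convex function `H ↦ tr (exp H)`. -/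
lemma trace_exp_gradient {H K : Matrix ι ι ℝ} (hH : H.IsSymm) (hK : K.IsSymm) :
    trace (exp K) + trace (exp K * (H - K)) ≤ trace (exp H) := by
  obtain ⟨W, l, hW, hW', rfl⟩ := IsSymm.exists_spectral hH
  obtain ⟨Z, k, hZ, hZ', rfl⟩ := IsSymm.exists_spectral hK
  rw [exp_spectral l hW, exp_spectral k hZ, Matrix.mul_sub, trace_sub, trace_spectral_mul,
    trace_spectral_mul, trace_spectral _ hW, trace_spectral _ hZ]
  have hO : (Wᵀ * Z) * (Wᵀ * Z)ᵀ = 1 := by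
    rw [transpose_mul, transpose_transpose, Matrix.mul_assoc, ← Matrix.mul_assoc Z, hZ',
      Matrix.one_mul, hW]
  have hO' : (Wᵀ * Z)ᵀ * (Wᵀ * Z)ᵀᵀ = 1 := by
    rw [transpose_transpose, transpose_mul, transpose_transpose, Matrix.mul_assoc,
      ← Matrix.mul_assoc W, hW', Matrix.one_mul, hZ]
  rw [hZ]
  set O := Wᵀ * Z
  -- The squared entries of the orthogonal matrix `O` are doubly stochastic, so every trace becomes
  -- a sum over pairs `(i, j)` with the same weights; what remains is the scalar tangent inequality
  -- for `exp`.
  have e1 : ∑ i, Real.exp (l i) = ∑ i, ∑ j, O i j ^ 2 * Real.exp (l i) := by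
    refine Finset.sum_congr rfl fun i _ => ?_
    rw [← Finset.sum_mul, sum_sq_row hO, one_mul]
  have e2 (f : ι → ℝ) : ∑ j, f j = ∑ i, ∑ j, O i j ^ 2 * f j := by
    rw [Finset.sum_comm]
    refine Finset.sum_congr rfl fun j _ => ?_
    have := sum_sq_row hO' j
    simp only [transpose_apply] at this
    rw [← Finset.sum_mul, this, one_mul]
  have e3 : ∑ i, ∑ j, (1 : Matrix ι ι ℝ) i j ^ 2 * (k i * Real.exp (k j)) =
      ∑ j, k j * Real.exp (k j) := by
    refine Finset.sum_congr rfl fun i _ => ?_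
    simp [one_apply]
  rw [e3, e1, e2 (fun j => Real.exp (k j)), e2 (fun j => k j * Real.exp (k j)),
    ← Finset.sum_sub_distrib, ← Finset.sum_add_distrib]
  refine Finset.sum_le_sum fun i _ => ?_
  rw [← Finset.sum_sub_distrib, ← Finset.sum_add_distrib]
  refine Finset.sum_le_sum fun j _ => ?_
  have h1 := Real.add_one_le_exp (l i - k j)
  have h2 : Real.exp (l i) = Real.exp (k j) * Real.exp (l i - k j) := by
    rw [← Real.exp_add]; ring_nf
  have h3 : Real.exp (k j) * (l i - k j + 1) ≤ Real.exp (l i) := by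
    rw [h2]; exact mul_le_mul_of_nonneg_left h1 (Real.exp_nonneg _)
  nlinarith [mul_le_mul_of_nonneg_left h3 (sq_nonneg (O i j))]

lemma quad_exp_nonneg {H : Matrix ι ι ℝ} (hH : H.IsSymm) (v : ι → ℝ) :
    0 ≤ v ⬝ᵥ exp H *ᵥ v := by
  obtain ⟨W, l, hW, hW', rfl⟩ := IsSymm.exists_spectral hH
  rw [exp_spectral l hW, quad_spectral]
  positivity

lemma trace_exp_nonneg {H : Matrix ι ι ℝ} (hH : H.IsSymm) : 0 ≤ trace (exp H) := by
  obtain ⟨W, l, hW, hW', rfl⟩ := IsSymm.exists_spectral hH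
  rw [exp_spectral l hW, trace_spectral _ hW]
  positivity

/-- In the eigenbases of the two matrices the left side becomes a sum of divided differences of
`exp`, weighted by `s aᵢ² bⱼ²`, where `a` and `b` are the coordinates of `v`. Bounding each by the
arithmetic mean decouples the sum, since `∑ aᵢ² = ∑ bⱼ² = v ⬝ᵥ v`. -/
lemma quad_exp_sub_le {H : Matrix ι ι ℝ} (hH : H.IsSymm) (v : ι → ℝ) {s : ℝ} (hs : 0 ≤ s) :
    v ⬝ᵥ exp H *ᵥ v - v ⬝ᵥ exp (H - s • vecMulVec v v) *ᵥ v ≤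
      s / 2 * (v ⬝ᵥ v) * (v ⬝ᵥ exp H *ᵥ v + v ⬝ᵥ exp (H - s • vecMulVec v v) *ᵥ v) := by
  have hK : (H - s • vecMulVec v v).IsSymm := hH.sub ((isSymm_vecMulVec_self v).smul s)
  obtain ⟨K, hKd⟩ : ∃ K, K = H - s • vecMulVec v v := ⟨_, rfl⟩
  have hdiff : H - K = s • vecMulVec v v := by rw [hKd]; abel
  rw [← hKd] at hK ⊢
  clear hKd
  obtain ⟨W, l, hW, hW', rfl⟩ := IsSymm.exists_spectral hH
  obtain ⟨Z, k, hZ, hZ', rfl⟩ := IsSymm.exists_spectral hK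
  rw [exp_spectral l hW, exp_spectral k hZ, quad_spectral, quad_spectral]
  obtain ⟨a, ha⟩ : ∃ a, a = Wᵀ *ᵥ v := ⟨_, rfl⟩
  obtain ⟨b, hb⟩ : ∃ b, b = Zᵀ *ᵥ v := ⟨_, rfl⟩
  obtain ⟨O, hOd⟩ : ∃ O, O = Wᵀ * Z := ⟨_, rfl⟩
  have hab : a = O *ᵥ b := by
    rw [hOd, ha, hb, mulVec_mulVec, Matrix.mul_assoc, hZ', Matrix.mul_one]
  have hba : b = Oᵀ *ᵥ a := by
    rw [hOd, ha, hb, mulVec_mulVec, transpose_mul, transpose_transpose, Matrix.mul_assoc, hW',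
      Matrix.mul_one]
  have hva : v ⬝ᵥ v = ∑ i, a i ^ 2 := by
    have := quad_spectral W 1 v
    rw [← ha] at this
    simpa [diagonal_one, hW'] using this
  have hvb : v ⬝ᵥ v = ∑ i, b i ^ 2 := by
    have := quad_spectral Z 1 v
    rw [← hb] at this
    simpa [diagonal_one, hZ'] using this
  -- The identity `H - K = s v vᵀ`, sandwiched between the two eigenbases, determines the overlaps
  -- `O i j` wherever `l i ≠ k j`.
  have key : ∀ i j, (l i - k j) * O i j = s * (a i * b j) := by
    have h1 : Wᵀ * (W * diagonal l * Wᵀ - Z * diagonal k * Zᵀ) * Z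
        = diagonal l * O - O * diagonal k := by
      rw [hOd, Matrix.mul_sub, Matrix.sub_mul]
      congr 1
      · simp only [← Matrix.mul_assoc, hW, Matrix.one_mul]
      · simp only [Matrix.mul_assoc, hZ, Matrix.mul_one]
    have h2 : Wᵀ * (s • vecMulVec v v) * Z = s • vecMulVec a b := by
      rw [Matrix.mul_smul, Matrix.smul_mul, mul_vecMulVec, vecMulVec_mul, ha, hb,
        ← mulVec_transpose]
    intro i j
    have := congrFun (congrFun (h1.symm.trans ((congrArg (fun X => Wᵀ * X * Z) hdiff).trans h2)) i) j
    rw [Matrix.sub_apply, diagonal_mul, mul_diagonal, Matrix.smul_apply, vecMulVec_apply,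
      smul_eq_mul] at this
    rw [← this]; ring
  rw [← ha, ← hb]
  have e1 : ∑ i, Real.exp (l i) * a i ^ 2 = ∑ i, ∑ j, a i * b j * O i j * Real.exp (l i) := by
    refine Finset.sum_congr rfl fun i _ => ?_
    have : a i = ∑ j, O i j * b j := congrFun hab i
    rw [sq]
    conv_lhs => rw [← mul_assoc, this]
    rw [Finset.mul_sum, ← this]
    exact Finset.sum_congr rfl fun j _ => by ring
  have e2 : ∑ j, Real.exp (k j) * b j ^ 2 = ∑ i, ∑ j, a i * b j * O i j * Real.exp (k j) := by
    rw [Finset.sum_comm]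
    refine Finset.sum_congr rfl fun j _ => ?_
    have : b j = ∑ i, O i j * a i := congrFun hba j
    rw [sq]
    conv_lhs => rw [← mul_assoc, this]
    rw [Finset.mul_sum, ← this]
    exact Finset.sum_congr rfl fun i _ => by ring
  have e3 : s / 2 * (v ⬝ᵥ v) * (∑ i, Real.exp (l i) * a i ^ 2 + ∑ j, Real.exp (k j) * b j ^ 2) =
      ∑ i, ∑ j, s / 2 * (a i ^ 2 * b j ^ 2) * (Real.exp (l i) + Real.exp (k j)) := by
    rw [mul_add]
    conv_lhs => enter [1]; rw [hvb]
    conv_lhs => enter [2]; rw [hva]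
    simp only [mul_add, Finset.sum_add_distrib]
    congr 1
    · rw [mul_assoc, Finset.sum_mul_sum, Finset.sum_comm, Finset.mul_sum]
      refine Finset.sum_congr rfl fun i _ => ?_
      rw [Finset.mul_sum]
      exact Finset.sum_congr rfl fun j _ => by ring
    · rw [mul_assoc, Finset.sum_mul_sum, Finset.mul_sum]
      refine Finset.sum_congr rfl fun i _ => ?_
      rw [Finset.mul_sum]
      exact Finset.sum_congr rfl fun j _ => by ring
  rw [e3, e1, e2, ← Finset.sum_sub_distrib]
  refine Finset.sum_le_sum fun i _ => ?_
  rw [← Finset.sum_sub_distrib]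
  refine Finset.sum_le_sum fun j _ => ?_
  have hk := key i j
  rw [← mul_sub]
  rcases eq_or_ne (l i) (k j) with h | h
  · rw [h, sub_self, mul_zero]; positivity
  have hO : O i j = s * (a i * b j) / (l i - k j) := by
    rw [eq_div_iff (sub_ne_zero.2 h), ← hk]; ring
  have hmean : (Real.exp (l i) - Real.exp (k j)) / (l i - k j) ≤
      (Real.exp (l i) + Real.exp (k j)) / 2 := by
    rcases lt_or_gt_of_ne h with h' | h'
    · rw [← neg_div_neg_eq, div_le_iff₀ (by linarith)]
      linarith [exp_sub_exp_le_mean h'.le]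
    · rw [div_le_iff₀ (by linarith)]
      linarith [exp_sub_exp_le_mean h'.le]
  calc a i * b j * O i j * (Real.exp (l i) - Real.exp (k j))
      = s * (a i ^ 2 * b j ^ 2) * ((Real.exp (l i) - Real.exp (k j)) / (l i - k j)) := by
        rw [hO]; ring
    _ ≤ s * (a i ^ 2 * b j ^ 2) * ((Real.exp (l i) + Real.exp (k j)) / 2) := by gcongr
    _ = _ := by ring

/-- One small step along a rank-one direction. -/
lemma quad_exp_step {H : Matrix ι ι ℝ} (hH : H.IsSymm) (v : ι → ℝ) {s : ℝ} (hs : 0 ≤ s) :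
    (1 - s * (v ⬝ᵥ v)) * (v ⬝ᵥ exp H *ᵥ v) ≤ v ⬝ᵥ exp (H - s • vecMulVec v v) *ᵥ v := by
  have h := quad_exp_sub_le hH v hs
  have h0 := quad_exp_nonneg hH v
  have hx : 0 ≤ v ⬝ᵥ v := dotProduct_self_nonneg v
  set p := v ⬝ᵥ exp H *ᵥ v
  set q := v ⬝ᵥ exp (H - s • vecMulVec v v) *ᵥ v
  have hy : 0 ≤ s * (v ⬝ᵥ v) := mul_nonneg hs hx
  set y := s * (v ⬝ᵥ v) with hyd
  have h' : p - q ≤ y / 2 * (p + q) := by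
    rw [hyd]; linarith
  -- `(1 + y/2) (1 - y) ≤ 1 - y/2`.
  by_contra hc
  push Not at hc
  nlinarith [mul_nonneg hy h0, mul_nonneg (mul_nonneg hy hy) h0]

lemma trace_exp_sub_step {H : Matrix ι ι ℝ} (hH : H.IsSymm) (v : ι → ℝ) (s : ℝ) :
    s * (v ⬝ᵥ exp (H - s • vecMulVec v v) *ᵥ v) ≤
      trace (exp H) - trace (exp (H - s • vecMulVec v v)) := by
  have hK : (H - s • vecMulVec v v).IsSymm := hH.sub ((isSymm_vecMulVec_self v).smul s)
  have h := trace_exp_gradient hH hK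
  rw [sub_sub_cancel, Matrix.mul_smul, trace_smul, mul_vecMulVec, trace_vecMulVec, smul_eq_mul,
    dotProduct_comm] at h
  linarith

/-- The quadratic form shrinks at most geometrically along the steps, so the trace decrements sum to
at least a geometric series. Multiplying through by `v ⬝ᵥ v` avoids a division when `v = 0`. -/
lemma trace_exp_sub_iterate {H : Matrix ι ι ℝ} (hH : H.IsSymm) (v : ι → ℝ) {s : ℝ} (hs : 0 ≤ s)
    (hy : s * (v ⬝ᵥ v) ≤ 1) (n : ℕ) :
    (1 - s * (v ⬝ᵥ v)) ^ n * (v ⬝ᵥ exp H *ᵥ v) ≤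
        v ⬝ᵥ exp (H - (n * s) • vecMulVec v v) *ᵥ v ∧
    (1 - s * (v ⬝ᵥ v)) * (1 - (1 - s * (v ⬝ᵥ v)) ^ n) * (v ⬝ᵥ exp H *ᵥ v) ≤
      (v ⬝ᵥ v) * (trace (exp H) - trace (exp (H - (n * s) • vecMulVec v v))) := by
  have hx : 0 ≤ v ⬝ᵥ v := dotProduct_self_nonneg v
  induction n with
  | zero => simp
  | succ n ih =>
    obtain ⟨ih1, ih2⟩ := ih
    have hK : (H - ((n : ℝ) * s) • vecMulVec v v).IsSymm :=
      hH.sub ((isSymm_vecMulVec_self v).smul _)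
    have e : H - (((n + 1 : ℕ) : ℝ) * s) • vecMulVec v v =
        H - ((n : ℝ) * s) • vecMulVec v v - s • vecMulVec v v := by
      rw [sub_sub, ← add_smul]; push_cast; ring_nf
    have h1 := quad_exp_step hK v hs
    have h2 := trace_exp_sub_step hK v s
    rw [← e] at h1 h2
    have h3 := mul_le_mul_of_nonneg_left ih1 (sub_nonneg.2 hy)
    have h4 : (1 - s * (v ⬝ᵥ v)) ^ (n + 1) * (v ⬝ᵥ exp H *ᵥ v) ≤
        v ⬝ᵥ exp (H - (((n + 1 : ℕ) : ℝ) * s) • vecMulVec v v) *ᵥ v := by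
      rw [pow_succ']; linarith
    refine ⟨h4, ?_⟩
    have h5 := mul_le_mul_of_nonneg_left h4 (mul_nonneg hs hx)
    have h6 := mul_le_mul_of_nonneg_left h2 hx
    rw [pow_succ'] at h5 ⊢
    nlinarith

/-- A Golden–Thompson inequality for rank-one perturbations. -/
lemma trace_exp_sub_rankOne {H : Matrix ι ι ℝ} (hH : H.IsSymm) (v : ι → ℝ) {s : ℝ} (hs : 0 ≤ s) :
    (1 - Real.exp (-(s * (v ⬝ᵥ v)))) * (v ⬝ᵥ exp H *ᵥ v) ≤
      (v ⬝ᵥ v) * (trace (exp H) - trace (exp (H - s • vecMulVec v v))) := by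
  have hx : 0 ≤ v ⬝ᵥ v := dotProduct_self_nonneg v
  have h0 := quad_exp_nonneg hH v
  set y := s * (v ⬝ᵥ v) with hyd
  have hy : 0 ≤ y := mul_nonneg hs hx
  -- Take `n` steps of size `s / n` and let `n → ∞`: the geometric factor `(1 - y/n)^n` is at most
  -- `exp (-y)`, and the loss `1 - y/n` tends to `1`.
  have hlim : Filter.Tendsto (fun n : ℕ => (1 - y / n) * (1 - Real.exp (-y)) * (v ⬝ᵥ exp H *ᵥ v))
      Filter.atTop (nhds ((1 - 0) * (1 - Real.exp (-y)) * (v ⬝ᵥ exp H *ᵥ v))) :=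
    ((tendsto_const_nhds.sub (tendsto_const_div_atTop_nhds_zero_nat y)).mul_const _).mul_const _
  rw [sub_zero, one_mul] at hlim
  refine le_of_tendsto hlim ?_
  obtain ⟨n0, hn0⟩ := exists_nat_ge y
  filter_upwards [Filter.eventually_ge_atTop (max n0 1)] with n hn
  have hn1 : 1 ≤ n := (le_max_right _ _).trans hn
  have hnpos : (0 : ℝ) < n := by exact_mod_cast hn1
  have hny : y ≤ n := hn0.trans (by exact_mod_cast (le_max_left _ _).trans hn)
  have hyn : s / n * (v ⬝ᵥ v) = y / n := by rw [hyd]; ring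
  have hyn1 : y / n ≤ 1 := (div_le_one hnpos).2 hny
  have h := (trace_exp_sub_iterate hH v (div_nonneg hs hnpos.le) (by rw [hyn]; exact hyn1) n).2
  rw [hyn, mul_div_cancel₀ _ hnpos.ne'] at h
  refine le_trans ?_ h
  have hpow : (1 - y / n) ^ n ≤ Real.exp (-y) := Real.one_sub_div_pow_le_exp_neg hny
  gcongr

end TraceExponential

end CURPlus

namespace CURPlus

open Matrix NormedSpace

/-! ### Sampling without versus with replacement -/

section Hoeffding

variable {α E : Type*} [Fintype α] [DecidableEq α] [AddCommGroup E] [Module ℝ E]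

lemma exists_perm_maps_into {d : ℕ} (f : Fin d → α) (J : Finset α) (hJ : J.card = d) :
    ∃ (p : Equiv.Perm α) (g : Fin d → J), ∀ i, p (f i) = g i := by
  obtain ⟨J', hJ', hc⟩ := Finset.exists_subset_card_eq
    (show (Finset.univ.image f).card ≤ J.card by
      rw [hJ]; exact Finset.card_image_le.trans (by simp))
  have e : {x // x ∈ Finset.univ.image f} ≃ {x // x ∈ J'} :=
    Fintype.equivOfCardEq (by rw [Fintype.card_coe, Fintype.card_coe, hc])
  refine ⟨e.extendSubtype, fun i => ⟨e.extendSubtype (f i), hJ' ?_⟩, fun i => rfl⟩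
  exact e.extendSubtype_mem _ (Finset.mem_image_of_mem _ (Finset.mem_univ _))

lemma sum_perm_apply {β : Type*} [Fintype β] [DecidableEq β] (F : β → E) (b : β) :
    ∑ p : Equiv.Perm β, F (p b) =
      ((Fintype.card β).factorial / Fintype.card β : ℝ) • ∑ c, F c := by
  have h (c : β) : ∑ p : Equiv.Perm β, F (p c) = ∑ p : Equiv.Perm β, F (p b) := by
    rw [← Equiv.sum_comp (Equiv.mulRight (Equiv.swap c b))]
    simp
  have h2 : (Fintype.card β : ℝ) • ∑ p : Equiv.Perm β, F (p b) =
      ((Fintype.card β).factorial : ℝ) • ∑ c, F c := by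
    have h3 : ∑ c, ∑ p : Equiv.Perm β, F (p c) = ∑ p : Equiv.Perm β, ∑ c, F c := by
      rw [Finset.sum_comm]
      exact Finset.sum_congr rfl fun p _ => Equiv.sum_comp p F
    rw [Finset.sum_congr rfl fun c _ => h c, Finset.sum_const, Finset.sum_const, Finset.card_univ,
      Finset.card_univ, Fintype.card_perm] at h3
    rw [Nat.cast_smul_eq_nsmul, Nat.cast_smul_eq_nsmul]
    exact h3
  have hb : (Fintype.card β : ℝ) ≠ 0 := by
    have : Nonempty β := ⟨b⟩
    exact_mod_cast Fintype.card_ne_zero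
  rw [div_eq_inv_mul, mul_smul, ← h2, smul_smul, inv_mul_cancel₀ hb, one_smul]

variable {C : Set E} {φ : E → ℝ}

/-- A permutation moves the values of `f` into `J`, which leaves the sum over all `p` unchanged.
Averaging over the permutations of `J` then turns each of the `d` draws into the mean over `J`, so
their sum averages to the sum over `J`; Jensen's inequality concludes. -/
lemma sum_perm_subset_le (hφ : ConvexOn ℝ C φ) (Y : α → E) {d : ℕ}
    (hY : ∀ f : Fin d → α, ∑ i, Y (f i) ∈ C) (f : Fin d → α) (J : Finset α) (hJ : J.card = d) :
    ∑ p : Equiv.Perm α, φ (∑ j ∈ J, Y (p j)) ≤ ∑ p : Equiv.Perm α, φ (∑ i, Y (p (f i))) := by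
  obtain ⟨q, g, hg⟩ := exists_perm_maps_into f J hJ
  have h1 (r : Equiv.Perm J) : ∑ p : Equiv.Perm α, φ (∑ i, Y (p (f i))) =
      ∑ p : Equiv.Perm α, φ (∑ i, Y (p (r (g i)))) := by
    rw [← Equiv.sum_comp (Equiv.mulRight (Equiv.Perm.ofSubtype r * q))
      (fun p : Equiv.Perm α => φ (∑ i, Y (p (f i))))]
    refine Finset.sum_congr rfl fun p _ => ?_
    congr 1
    refine Finset.sum_congr rfl fun i _ => ?_
    rw [Equiv.coe_mulRight, Equiv.Perm.mul_apply, Equiv.Perm.mul_apply, hg i,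
      Equiv.Perm.ofSubtype_apply_coe]
  have hcard : Fintype.card J = d := by simpa using hJ
  have hfac : (0 : ℝ) < (d.factorial : ℝ) := by exact_mod_cast d.factorial_pos
  have hmean (p : Equiv.Perm α) :
      ∑ r : Equiv.Perm J, ((d.factorial : ℝ)⁻¹) • ∑ i, Y (p (r (g i))) = ∑ j ∈ J, Y (p j) := by
    rw [← Finset.smul_sum, Finset.sum_comm]
    rw [Finset.sum_congr rfl fun i _ => sum_perm_apply (fun j : J => Y (p j)) (g i)]
    rw [Finset.sum_const, Finset.card_univ, Fintype.card_fin, hcard,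
      Finset.sum_coe_sort J (fun j => Y (p j)), ← Nat.cast_smul_eq_nsmul ℝ, smul_smul, smul_smul]
    rcases Nat.eq_zero_or_pos d with h | h
    · rw [Finset.card_eq_zero.1 (hJ.trans h)]; simp
    · have : (d : ℝ) ≠ 0 := by exact_mod_cast h.ne'
      rw [show (d.factorial : ℝ)⁻¹ * d * (d.factorial / d) = 1 by field_simp, one_smul]
  have hjensen (p : Equiv.Perm α) : φ (∑ j ∈ J, Y (p j)) ≤
      ∑ r : Equiv.Perm J, (d.factorial : ℝ)⁻¹ * φ (∑ i, Y (p (r (g i)))) := by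
    rw [← hmean p]
    refine hφ.map_sum_le (fun _ _ => by positivity) ?_ (fun r _ => hY fun i => p (r (g i)))
    rw [Finset.sum_const, Finset.card_univ, Fintype.card_perm, hcard, nsmul_eq_mul,
      mul_inv_cancel₀ hfac.ne']
  calc ∑ p : Equiv.Perm α, φ (∑ j ∈ J, Y (p j))
      ≤ ∑ p : Equiv.Perm α, ∑ r : Equiv.Perm J,
          (d.factorial : ℝ)⁻¹ * φ (∑ i, Y (p (r (g i)))) := Finset.sum_le_sum fun p _ => hjensen p
    _ = ∑ r : Equiv.Perm J, (d.factorial : ℝ)⁻¹ * ∑ p : Equiv.Perm α, φ (∑ i, Y (p (f i))) := by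
        rw [Finset.sum_comm]
        refine Finset.sum_congr rfl fun r _ => ?_
        rw [h1 r, Finset.mul_sum]
    _ = ∑ p : Equiv.Perm α, φ (∑ i, Y (p (f i))) := by
        rw [Finset.sum_const, Finset.card_univ, Fintype.card_perm, hcard, nsmul_eq_mul,
          mul_inv_cancel_left₀ hfac.ne']

/-- Hoeffding's comparison of sampling without and with replacement, for convex functions. -/
lemma sum_powersetCard_le (hφ : ConvexOn ℝ C φ) (Y : α → E) {d : ℕ}
    (hY : ∀ f : Fin d → α, ∑ i, Y (f i) ∈ C) :
    (Fintype.card α : ℝ) ^ d * ∑ J ∈ Finset.powersetCard d Finset.univ, φ (∑ j ∈ J, Y j) ≤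
      (Fintype.card α).choose d * ∑ f : Fin d → α, φ (∑ i, Y (f i)) := by
  set S := Finset.powersetCard d (Finset.univ : Finset α) with hS
  have hScard : S.card = (Fintype.card α).choose d := by
    rw [hS, Finset.card_powersetCard, Finset.card_univ]
  have hJ (p : Equiv.Perm α) :
      ∑ J ∈ S, φ (∑ j ∈ J, Y (p j)) = ∑ J ∈ S, φ (∑ j ∈ J, Y j) := by
    refine Finset.sum_equiv (Equiv.finsetCongr p) (fun J => ?_) fun J _ => ?_
    · simp [hS, Finset.mem_powersetCard]
    · simp [Finset.sum_map]
  have hf (p : Equiv.Perm α) :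
      ∑ f : Fin d → α, φ (∑ i, Y (p (f i))) = ∑ f : Fin d → α, φ (∑ i, Y (f i)) :=
    Equiv.sum_comp (Equiv.arrowCongr (Equiv.refl (Fin d)) p) fun f => φ (∑ i, Y (f i))
  -- Double counting over all `J`, `f` and `p`: relabelling `α` by `p` permutes the subsets `J` and
  -- the maps `f`, so `p` drops out of both sides.
  have hsum : ∑ J ∈ S, ∑ f : Fin d → α, ∑ p : Equiv.Perm α, φ (∑ j ∈ J, Y (p j)) ≤
      ∑ J ∈ S, ∑ f : Fin d → α, ∑ p : Equiv.Perm α, φ (∑ i, Y (p (f i))) :=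
    Finset.sum_le_sum fun J hJ => Finset.sum_le_sum fun f _ =>
      sum_perm_subset_le hφ Y hY f J (Finset.mem_powersetCard.1 hJ).2
  have hfac : (0 : ℝ) < ((Fintype.card α).factorial : ℝ) := by
    exact_mod_cast (Fintype.card α).factorial_pos
  have hL : ∑ J ∈ S, ∑ f : Fin d → α, ∑ p : Equiv.Perm α, φ (∑ j ∈ J, Y (p j)) =
      (Fintype.card α).factorial * ((Fintype.card α : ℝ) ^ d * ∑ J ∈ S, φ (∑ j ∈ J, Y j)) := by
    simp only [Finset.sum_const, Finset.card_univ, Fintype.card_pi, Finset.prod_const,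
      Fintype.card_fin, nsmul_eq_mul]
    rw [← Finset.mul_sum, Finset.sum_comm, Finset.sum_congr rfl fun p _ => hJ p]
    simp only [Finset.sum_const, Finset.card_univ, Fintype.card_perm, nsmul_eq_mul]
    push_cast; ring
  have hR : ∑ J ∈ S, ∑ f : Fin d → α, ∑ p : Equiv.Perm α, φ (∑ i, Y (p (f i))) =
      (Fintype.card α).factorial *
        ((Fintype.card α).choose d * ∑ f : Fin d → α, φ (∑ i, Y (f i))) := by
    rw [Finset.sum_comm, Finset.sum_congr rfl fun f _ => Finset.sum_comm]
    simp only [Finset.sum_const, hScard, nsmul_eq_mul]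
    rw [Finset.sum_comm]
    simp only [← Finset.mul_sum]
    rw [Finset.sum_congr rfl fun p _ => hf p]
    simp only [Finset.sum_const, Finset.card_univ, Fintype.card_perm, nsmul_eq_mul]
    ring
  rw [hL, hR] at hsum
  exact le_of_mul_le_mul_left hsum hfac

end Hoeffding

/-! ### A matrix Chernoff bound -/

section Chernoff

variable {α ι : Type*} [Fintype α] [Fintype ι] [DecidableEq ι]

/-- Apply the gradient inequality at the convex combination towards both endpoints; the first-order
terms cancel. -/
lemma convexOn_trace_exp (s : ℝ) :
    ConvexOn ℝ {X : Matrix ι ι ℝ | X.IsSymm} fun X => trace (exp (-(s • X))) := by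
  have hC : Convex ℝ {X : Matrix ι ι ℝ | X.IsSymm} := fun x hx y hy a b _ _ _ =>
    (Matrix.IsSymm.smul hx a).add (Matrix.IsSymm.smul hy b)
  refine ⟨hC, fun x hx y hy a b ha hb hab => ?_⟩
  have hz := hC hx hy ha hb hab
  have gx := trace_exp_gradient (Matrix.IsSymm.smul hx s).neg (Matrix.IsSymm.smul hz s).neg
  have gy := trace_exp_gradient (Matrix.IsSymm.smul hy s).neg (Matrix.IsSymm.smul hz s).neg
  set z := a • x + b • y with hzd
  have hcomb : a • (-(s • x) - -(s • z)) + b • (-(s • y) - -(s • z)) = 0 := by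
    have : z = (a + b) • z := by rw [hab, one_smul]
    have h2 : a • (-(s • x) - -(s • z)) + b • (-(s • y) - -(s • z)) =
        s • ((a + b) • z - (a • x + b • y)) := by module
    rw [h2, hab, one_smul, ← hzd, sub_self, smul_zero]
  have htr : a * trace (exp (-(s • z)) * (-(s • x) - -(s • z))) +
      b * trace (exp (-(s • z)) * (-(s • y) - -(s • z))) = 0 := by
    rw [← smul_eq_mul a, ← smul_eq_mul b, ← trace_smul, ← trace_smul, ← trace_add,
      ← Matrix.mul_smul, ← Matrix.mul_smul, ← Matrix.mul_add, hcomb, Matrix.mul_zero, trace_zero]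
  have h1 := mul_le_mul_of_nonneg_left gx ha
  have h2 := mul_le_mul_of_nonneg_left gy hb
  have h3 : (a + b) * trace (exp (-(s • z))) = trace (exp (-(s • z))) := by rw [hab, one_mul]
  simp only [smul_eq_mul]
  linarith

lemma one_sub_exp_concave {s x R : ℝ} (hx : 0 ≤ x) (hxR : x ≤ R) (hR : 0 < R) :
    x / R * (1 - Real.exp (-(s * R))) ≤ 1 - Real.exp (-(s * x)) := by
  have h := convexOn_exp.2 (Set.mem_univ (-(s * R))) (Set.mem_univ 0) (div_nonneg hx hR.le)
    (sub_nonneg.2 ((div_le_one hR).2 hxR)) (add_sub_cancel _ _)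
  simp only [smul_eq_mul, mul_zero, add_zero, Real.exp_zero, mul_one] at h
  have e : x / R * -(s * R) = -(s * x) := by field_simp
  rw [e] at h
  linarith

variable {v : α → ι → ℝ}

/-- The contraction from one independent draw. Concavity replaces `1 - exp (-s x)` by its chord on
`[0, R]`, making the rank-one bound linear in `v vᵀ`; these sum to the identity. -/
lemma sum_trace_exp_step (hv : ∑ a, vecMulVec (v a) (v a) = 1) {R s : ℝ} (hR : 0 < R) (hs : 0 ≤ s)
    (hvR : ∀ a, v a ⬝ᵥ v a ≤ R) {H : Matrix ι ι ℝ} (hH : H.IsSymm) :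
    ∑ a, trace (exp (H - s • vecMulVec (v a) (v a))) ≤
      (Fintype.card α - (1 - Real.exp (-(s * R))) / R) * trace (exp H) := by
  have h1 (a : α) : (1 - Real.exp (-(s * R))) / R * (v a ⬝ᵥ exp H *ᵥ v a) ≤
      trace (exp H) - trace (exp (H - s • vecMulVec (v a) (v a))) := by
    rcases (dotProduct_self_nonneg (v a)).eq_or_lt with h | h
    · have : v a = 0 := dotProduct_self_eq_zero.1 h.symm
      rw [this]; simp
    · have h2 := trace_exp_sub_rankOne hH (v a) hs
      have h3 := mul_le_mul_of_nonneg_right (one_sub_exp_concave (s := s) h.le (hvR a) hR)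
        (quad_exp_nonneg hH (v a))
      refine le_of_mul_le_mul_left ?_ h
      calc _ = (v a ⬝ᵥ v a) / R * (1 - Real.exp (-(s * R))) * (v a ⬝ᵥ exp H *ᵥ v a) := by ring
        _ ≤ _ := h3.trans h2
  have h2 := Finset.sum_le_sum fun a (_ : a ∈ Finset.univ) => h1 a
  have h3 : ∑ a, v a ⬝ᵥ exp H *ᵥ v a = trace (exp H) := by
    have : trace (exp H * ∑ a, vecMulVec (v a) (v a)) = trace (exp H) := by
      rw [hv, Matrix.mul_one]
    rw [← this, Matrix.mul_sum, trace_sum]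
    refine Finset.sum_congr rfl fun a _ => ?_
    rw [mul_vecMulVec, trace_vecMulVec, dotProduct_comm]
  rw [← Finset.mul_sum, h3, Finset.sum_sub_distrib, Finset.sum_const, Finset.card_univ,
    nsmul_eq_mul] at h2
  linarith

lemma isSymm_sum_vecMulVec {κ ι : Type*} (S : Finset κ) (w : κ → ι → ℝ) :
    (∑ i ∈ S, vecMulVec (w i) (w i)).IsSymm := by
  rw [Matrix.IsSymm, transpose_sum]
  exact Finset.sum_congr rfl fun i _ => isSymm_vecMulVec_self (w i)

lemma sum_trace_exp_iid [Nonempty ι] (hv : ∑ a, vecMulVec (v a) (v a) = 1) {R s : ℝ} (hR : 0 < R)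
    (hs : 0 ≤ s) (hvR : ∀ a, v a ⬝ᵥ v a ≤ R) :
    0 ≤ Fintype.card α - (1 - Real.exp (-(s * R))) / R ∧ ∀ d : ℕ,
    ∑ f : Fin d → α, trace (exp (-(s • ∑ i, vecMulVec (v (f i)) (v (f i))))) ≤
      (Fintype.card α - (1 - Real.exp (-(s * R))) / R) ^ d * Fintype.card ι := by
  -- Nonnegativity is forced by the one-step bound at `H = 0`, whose left side is a sum of
  -- nonnegative traces.
  have hpos : 0 ≤ Fintype.card α - (1 - Real.exp (-(s * R))) / R := by
    have h := sum_trace_exp_step hv hR hs hvR (isSymm_zero : (0 : Matrix ι ι ℝ).IsSymm)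
    have h0 : 0 ≤ ∑ a, trace (exp ((0 : Matrix ι ι ℝ) - s • vecMulVec (v a) (v a))) :=
      Finset.sum_nonneg fun a _ => trace_exp_nonneg
        (isSymm_zero.sub ((isSymm_vecMulVec_self (v a)).smul s))
    rw [exp_zero, trace_one] at h
    exact nonneg_of_mul_nonneg_left (h0.trans h) (by exact_mod_cast Fintype.card_pos)
  refine ⟨hpos, fun d => ?_⟩
  induction d with
  | zero => simp
  | succ d ih =>
    rw [← Equiv.sum_comp (Fin.consEquiv fun _ : Fin (d + 1) => α), Fintype.sum_prod_type,
      Finset.sum_comm]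
    have h (f : Fin d → α) := sum_trace_exp_step hv hR hs hvR
      ((isSymm_sum_vecMulVec Finset.univ fun i => v (f i)).smul s).neg
    calc _ = ∑ f : Fin d → α, ∑ a, trace (exp (-(s • ∑ i, vecMulVec (v (f i)) (v (f i))) -
            s • vecMulVec (v a) (v a))) := by
          refine Finset.sum_congr rfl fun f _ => Finset.sum_congr rfl fun a _ => ?_
          simp only [Fin.consEquiv_apply, Fin.sum_univ_succ, Fin.cons_zero, Fin.cons_succ]
          congr 2
          rw [smul_add]; abel
      _ ≤ ∑ f : Fin d → α, (Fintype.card α - (1 - Real.exp (-(s * R))) / R) *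
            trace (exp (-(s • ∑ i, vecMulVec (v (f i)) (v (f i))))) :=
          Finset.sum_le_sum fun f _ => h f
      _ ≤ _ := by
          rw [← Finset.mul_sum, pow_succ', mul_assoc]
          exact mul_le_mul_of_nonneg_left ih hpos

lemma quad_sum_vecMulVec {κ ι : Type*} [Fintype ι] (S : Finset κ) (w : κ → ι → ℝ) (x : ι → ℝ) :
    x ⬝ᵥ (∑ i ∈ S, vecMulVec (w i) (w i)) *ᵥ x = ∑ i ∈ S, (w i ⬝ᵥ x) ^ 2 := by
  rw [Matrix.sum_mulVec, dotProduct_sum]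
  refine Finset.sum_congr rfl fun i _ => ?_
  rw [vecMulVec_mulVec, dotProduct_smul, dotProduct_comm x]
  simp [sq]

lemma exp_le_trace_exp {A : Matrix ι ι ℝ} (hA : A.IsSymm) {c : ℝ} {x : ι → ℝ}
    (hx : c * (x ⬝ᵥ x) < x ⬝ᵥ A *ᵥ x) : Real.exp c ≤ trace (exp A) := by
  obtain ⟨W, l, hW, hW', rfl⟩ := IsSymm.exists_spectral hA
  rw [exp_spectral l hW, trace_spectral _ hW]
  have hxx : x ⬝ᵥ x = ∑ i, (Wᵀ *ᵥ x) i ^ 2 := by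
    have := quad_spectral W 1 x
    simpa [diagonal_one, hW'] using this
  rw [quad_spectral, hxx, Finset.mul_sum] at hx
  obtain ⟨i, _, hi⟩ := Finset.exists_lt_of_sum_lt hx
  have hci : c ≤ l i := (lt_of_mul_lt_mul_right hi (sq_nonneg _)).le
  exact (Real.exp_le_exp.2 hci).trans
    (Finset.single_le_sum (f := fun i => Real.exp (l i)) (fun j _ => (Real.exp_pos _).le)
      (Finset.mem_univ i))

/-- A matrix Chernoff bound for the smallest eigenvalue of a random sample, drawn without
replacement, from a decomposition of the identity. -/
lemma card_ill_conditioned_le [DecidableEq α] [Nonempty ι] [Nonempty α] (hv : ∑ a, vecMulVec (v a) (v a) = 1)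
    {K t : ℝ} (hK : 0 < K) (ht : 0 ≤ t) (hvK : ∀ a, v a ⬝ᵥ v a ≤ K / Fintype.card α) {d : ℕ}
    (hd : 7 * K * (t + Real.log (Fintype.card ι)) ≤ d) {B : Finset (Finset α)}
    (hB : ∀ J ∈ B, J.card = d ∧
      ∃ x, ∑ j ∈ J, (v j ⬝ᵥ x) ^ 2 < d / (2 * Fintype.card α) * (x ⬝ᵥ x)) :
    (B.card : ℝ) ≤ Real.exp (-t) * (Fintype.card α).choose d := by
  set m : ℝ := (Fintype.card α : ℝ) with hm
  have hmpos : 0 < m := by rw [hm]; exact_mod_cast Fintype.card_pos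
  set k : ℝ := (Fintype.card ι : ℝ) with hk
  have hkpos : 0 < k := by rw [hk]; exact_mod_cast Fintype.card_pos
  have hR : 0 < K / m := div_pos hK hmpos
  set R := K / m with hRd
  -- This choice gives `exp (-(s R)) = 1/2`, so each draw contracts by `1 - 1/(2K)` relative to `m`.
  set s := Real.log 2 / R with hsd
  have hs : 0 < s := div_pos (Real.log_pos one_lt_two) hR
  have hsR : Real.exp (-(s * R)) = 1 / 2 := by
    rw [hsd, div_mul_cancel₀ _ hR.ne', Real.exp_neg, Real.exp_log two_pos, one_div]
  obtain ⟨hpos, hiid⟩ := sum_trace_exp_iid hv hR hs.le hvK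
  specialize hiid d
  rw [hsR] at hpos hiid
  have hho := sum_powersetCard_le (convexOn_trace_exp (ι := ι) s)
    (fun a => vecMulVec (v a) (v a)) (d := d)
    (fun f => isSymm_sum_vecMulVec Finset.univ fun i => v (f i))
  rw [← hm] at hpos hiid hho
  set c := d / (2 * m) with hc
  -- Markov's inequality: each ill-conditioned `J` contributes at least `exp (-(s c))`.
  have hBsum : (B.card : ℝ) * Real.exp (-(s * c)) ≤
      ∑ J ∈ Finset.powersetCard d Finset.univ,
        trace (exp (-(s • ∑ j ∈ J, vecMulVec (v j) (v j)))) := by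
    rw [← nsmul_eq_mul, ← Finset.sum_const]
    refine (Finset.sum_le_sum fun J hJ => ?_).trans
      (Finset.sum_le_sum_of_subset_of_nonneg (s := B) ?_ fun J _ _ =>
        trace_exp_nonneg ((isSymm_sum_vecMulVec J v).smul s).neg)
    · obtain ⟨-, x, hx⟩ := hB J hJ
      refine exp_le_trace_exp ((isSymm_sum_vecMulVec J v).smul s).neg (x := x) ?_
      rw [neg_mulVec, smul_mulVec, dotProduct_neg, dotProduct_smul, quad_sum_vecMulVec,
        smul_eq_mul]
      nlinarith [mul_lt_mul_of_pos_left hx hs]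
    · intro J hJ
      exact Finset.mem_powersetCard.2 ⟨Finset.subset_univ _, (hB J hJ).1⟩
  have hpow : (m - (1 - 1 / 2) / R) ^ d ≤ m ^ d * Real.exp (-(d / (2 * K))) := by
    have e : m - (1 - 1 / 2) / R = m * (1 - 1 / (2 * K)) := by
      rw [hRd]; field_simp; ring
    have h1 : 0 ≤ 1 - 1 / (2 * K) := by
      rw [e] at hpos; exact nonneg_of_mul_nonneg_right hpos hmpos
    rw [e, mul_pow]
    refine mul_le_mul_of_nonneg_left ?_ (by positivity)
    have h2 : 1 - 1 / (2 * K) ≤ Real.exp (-(1 / (2 * K))) := Real.one_sub_le_exp_neg _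
    refine (pow_le_pow_left₀ h1 h2 d).trans_eq ?_
    rw [← Real.exp_nat_mul]
    congr 1; ring
  set Ch : ℝ := ((Fintype.card α).choose d : ℝ) with hCh
  have hChain : (B.card : ℝ) * Real.exp (-(s * c)) ≤ Ch * (Real.exp (-(d / (2 * K))) * k) := by
    have h1 : m ^ d * ((B.card : ℝ) * Real.exp (-(s * c))) ≤
        m ^ d * (Ch * (Real.exp (-(d / (2 * K))) * k)) := by
      calc _ ≤ _ := mul_le_mul_of_nonneg_left hBsum (by positivity)
        _ ≤ _ := hho
        _ ≤ Ch * (m ^ d * Real.exp (-(d / (2 * K))) * k) := by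
            refine mul_le_mul_of_nonneg_left (hiid.trans ?_) (by positivity)
            exact mul_le_mul_of_nonneg_right hpow hkpos.le
        _ = _ := by ring
    exact le_of_mul_le_mul_left h1 (by positivity)
  -- The constant `7` enters here: `s c = log 2 · d/(2K)`, so the exponent is `-(1 - log 2) d/(2K)`,
  -- and `7/2 · (1 - log 2) > 1`.
  have hexp : Real.exp (-(d / (2 * K))) * k * Real.exp (s * c) ≤ Real.exp (-t) := by
    rw [← Real.exp_log hkpos, ← Real.exp_add, ← Real.exp_add, Real.exp_le_exp]
    have hsc : s * c = Real.log 2 * (d / (2 * K)) := by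
      rw [hsd, hc, hRd]; field_simp
    have hlogk : 0 ≤ Real.log k := by
      refine Real.log_nonneg ?_
      rw [hk]; exact_mod_cast Fintype.card_pos
    have hdK : 7 * (t + Real.log k) / 2 ≤ d / (2 * K) := by
      rw [div_le_div_iff₀ two_pos (by positivity)]
      nlinarith
    rw [hsc]
    nlinarith [Real.log_two_lt_d9, mul_le_mul_of_nonneg_left hdK
      (sub_nonneg.2 (Real.log_two_lt_d9.le.trans (by norm_num : (0.6931471808 : ℝ) ≤ 1)))]
  calc (B.card : ℝ) = (B.card : ℝ) * Real.exp (-(s * c)) * Real.exp (s * c) := by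
        rw [mul_assoc, ← Real.exp_add, neg_add_cancel, Real.exp_zero, mul_one]
    _ ≤ Ch * (Real.exp (-(d / (2 * K))) * k) * Real.exp (s * c) :=
        mul_le_mul_of_nonneg_right hChain (Real.exp_nonneg _)
    _ = Ch * (Real.exp (-(d / (2 * K))) * k * Real.exp (s * c)) := by ring
    _ ≤ Ch * Real.exp (-t) := mul_le_mul_of_nonneg_left hexp (by positivity)
    _ = _ := mul_comm _ _

end Chernoff

end CURPlus

namespace CURPlus

open Matrix

/-! ### Operator norms and projections -/

section OperatorBounds

variable {ι κ ρ : Type*} [Fintype ι] [Fintype κ] [Fintype ρ]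

/-- `c` bounds the square of the Euclidean operator norm of `X`. -/
def OpSqLE (X : Matrix ι κ ℝ) (c : ℝ) : Prop :=
  ∀ x : κ → ℝ, (X *ᵥ x) ⬝ᵥ (X *ᵥ x) ≤ c * (x ⬝ᵥ x)

lemma dotProduct_sq_le (x y : ι → ℝ) : (x ⬝ᵥ y) ^ 2 ≤ (x ⬝ᵥ x) * (y ⬝ᵥ y) := by
  have := Finset.sum_mul_sq_le_sq_mul_sq Finset.univ x y
  simpa [dotProduct, sq] using this

lemma dotProduct_self_eq_sum_sq (x : ι → ℝ) : x ⬝ᵥ x = ∑ i, x i ^ 2 := by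
  simp [dotProduct, sq]

/-- Cauchy–Schwarz on `|Xᵀ y|² = y ⬝ᵥ X Xᵀ y`, followed by cancelling one factor `|Xᵀ y|²`. -/
lemma OpSqLE.transpose {X : Matrix ι κ ℝ} {c : ℝ} (h : OpSqLE X c) (hc : 0 ≤ c) :
    OpSqLE Xᵀ c := by
  intro y
  have h1 : (Xᵀ *ᵥ y) ⬝ᵥ (Xᵀ *ᵥ y) = y ⬝ᵥ X *ᵥ (Xᵀ *ᵥ y) := by
    rw [mulVec_transpose, dotProduct_mulVec]
  have h2 := dotProduct_sq_le y (X *ᵥ (Xᵀ *ᵥ y))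
  have h3 := h (Xᵀ *ᵥ y)
  rw [← h1] at h2
  have hx := dotProduct_self_nonneg (Xᵀ *ᵥ y)
  have hy := dotProduct_self_nonneg y
  rcases hx.eq_or_lt with h0 | h0
  · rw [← h0]; positivity
  · refine le_of_mul_le_mul_right ?_ h0
    nlinarith [mul_le_mul_of_nonneg_left h3 hy]

lemma OpSqLE.sq_entry_le [DecidableEq κ] {X : Matrix ι κ ℝ} {c : ℝ} (h : OpSqLE X c) (i : ι)
    (j : κ) : X i j ^ 2 ≤ c := by
  have h1 := h (Pi.single j 1)
  rw [dotProduct_self_eq_sum_sq, mulVec_single_one] at h1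
  have h2 := Finset.single_le_sum (f := fun i => X.col j i ^ 2) (fun i _ => sq_nonneg _)
    (Finset.mem_univ i)
  simp only [single_one_dotProduct, Pi.single_eq_same, mul_one] at h1
  exact h2.trans h1

lemma opSqLE_frobenius (W : Matrix ι κ ℝ) : OpSqLE W (∑ i, ∑ j, W i j ^ 2) := by
  intro x
  rw [dotProduct_self_eq_sum_sq, dotProduct_self_eq_sum_sq x, Finset.sum_mul]
  exact Finset.sum_le_sum fun i _ => Finset.sum_mul_sq_le_sq_mul_sq Finset.univ (W i) x

lemma spectralNorm_sq_le {n m : ℕ} {X : Matrix (Fin n) (Fin m) ℝ} {c : ℝ} (hc : 0 ≤ c)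
    (h : OpSqLE X c) : spectralNorm X ^ 2 ≤ c := by
  have hn : spectralNorm X ≤ Real.sqrt c := by
    rw [spectralNorm, Matrix.l2_opNorm_def]
    refine ContinuousLinearMap.opNorm_le_bound _ (Real.sqrt_nonneg _) fun x => ?_
    refine abs_le_of_sq_le_sq' ?_ (by positivity) |>.2
    have := h (WithLp.ofLp x)
    rw [mul_pow, Real.sq_sqrt hc, EuclideanSpace.real_norm_sq_eq, EuclideanSpace.real_norm_sq_eq]
    rw [dotProduct_self_eq_sum_sq, dotProduct_self_eq_sum_sq] at this
    exact this
  have h0 : 0 ≤ spectralNorm X := by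
    rw [spectralNorm, Matrix.l2_opNorm_def]; exact norm_nonneg _
  calc spectralNorm X ^ 2 ≤ Real.sqrt c ^ 2 := pow_le_pow_left₀ h0 hn 2
    _ = c := Real.sq_sqrt hc

variable [DecidableEq κ]

lemma isometry_dotProduct {V : Matrix ι κ ℝ} (hV : Vᵀ * V = 1) (g h : κ → ℝ) :
    (V *ᵥ g) ⬝ᵥ (V *ᵥ h) = g ⬝ᵥ h := by
  rw [dotProduct_mulVec, ← mulVec_transpose, mulVec_mulVec, hV, one_mulVec]

lemma dotProduct_self_sub_projection [DecidableEq ι] {U : Matrix ι κ ℝ} (hU : Uᵀ * U = 1)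
    (z : ι → ℝ) :
    ((1 - U * Uᵀ) *ᵥ z) ⬝ᵥ ((1 - U * Uᵀ) *ᵥ z) = z ⬝ᵥ z - (Uᵀ *ᵥ z) ⬝ᵥ (Uᵀ *ᵥ z) := by
  rw [sub_mulVec, one_mulVec, ← mulVec_mulVec, sub_dotProduct, dotProduct_sub, dotProduct_sub,
    isometry_dotProduct hU]
  have h : z ⬝ᵥ U *ᵥ Uᵀ *ᵥ z = (Uᵀ *ᵥ z) ⬝ᵥ (Uᵀ *ᵥ z) := by
    rw [dotProduct_mulVec, ← mulVec_transpose]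
  rw [dotProduct_comm (U *ᵥ Uᵀ *ᵥ z) z, h]
  ring

lemma bessel [DecidableEq ι] {U : Matrix ι κ ℝ} (hU : Uᵀ * U = 1) (z : ι → ℝ) :
    (Uᵀ *ᵥ z) ⬝ᵥ (Uᵀ *ᵥ z) ≤ z ⬝ᵥ z := by
  have h := dotProduct_self_sub_projection hU z
  have h0 := dotProduct_self_nonneg ((1 - U * Uᵀ) *ᵥ z)
  linarith

lemma sum_dotProduct_le {p q : ι → ℝ} {a b A B : ℝ} (ha : 0 ≤ a) (hb : 0 ≤ b) (hA : 0 ≤ A)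
    (hB : 0 ≤ B) (hp : p ⬝ᵥ p ≤ a * A) (hq : q ⬝ᵥ q ≤ b * B) :
    (p + q) ⬝ᵥ (p + q) ≤ (a + b) * (A + B) := by
  have h1 := dotProduct_sq_le p q
  have h2 : (p ⬝ᵥ p) * (q ⬝ᵥ q) ≤ (a * A) * (b * B) :=
    mul_le_mul hp hq (dotProduct_self_nonneg q) (by positivity)
  have h3 : p ⬝ᵥ q ≤ (a * B + b * A) / 2 := by
    refine (abs_le_of_sq_le_sq' ?_ (by positivity)).2
    nlinarith [sq_nonneg (a * B - b * A)]
  rw [add_dotProduct, dotProduct_add, dotProduct_add, dotProduct_comm q p]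
  nlinarith

end OperatorBounds

/-! ### Error of the least squares estimate -/

section Assembly

variable {n m r : ℕ} {M : Matrix (Fin n) (Fin m) ℝ} {Uh : Matrix (Fin n) (Fin r) ℝ}
  {Vh : Matrix (Fin m) (Fin r) ℝ} {a b : ℝ}

/-- The matrix equals `(1 - P) M + Uh (Uhᵀ M (1 - Q) + W Vhᵀ)` with `P = Uh Uhᵀ` and `Q = Vh Vhᵀ`.
The two summands have orthogonal ranges, and the two terms in the bracket act on the orthogonal
parts `(1 - Q) x` and `Q x`, so the squared bounds add without cross terms. -/
lemma opSqLE_two_sided (hU : Uhᵀ * Uh = 1) (hV : Vhᵀ * Vh = 1) (ha : 0 ≤ a) (hb : 0 ≤ b)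
    (hMa : OpSqLE (Mᵀ * (1 - Uh * Uhᵀ)) a) (hMb : OpSqLE (M * (1 - Vh * Vhᵀ)) b)
    (W : Matrix (Fin r) (Fin r) ℝ) :
    OpSqLE (M - Uh * (Uhᵀ * M * Vh) * Vhᵀ + Uh * W * Vhᵀ) (a + b + ∑ i, ∑ j, W i j ^ 2) := by
  intro x
  have hP : (1 - Uh * Uhᵀ)ᵀ = 1 - Uh * Uhᵀ := by simp
  have hMa' : OpSqLE ((1 - Uh * Uhᵀ) * M) a := by
    have := hMa.transpose ha
    rwa [transpose_mul, transpose_transpose, hP] at this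
  have hPU : Uhᵀ * (1 - Uh * Uhᵀ) = 0 := by
    rw [Matrix.mul_sub, ← Matrix.mul_assoc, hU]; simp
  have hQQ : (1 - Vh * Vhᵀ) * (1 - Vh * Vhᵀ) = 1 - Vh * Vhᵀ := by
    have : Vh * Vhᵀ * (Vh * Vhᵀ) = Vh * Vhᵀ := by
      rw [Matrix.mul_assoc, ← Matrix.mul_assoc Vhᵀ, hV, Matrix.one_mul]
    rw [Matrix.sub_mul, Matrix.one_mul, Matrix.mul_sub, Matrix.mul_one, this]; simp
  set y := (1 - Vh * Vhᵀ) *ᵥ x with hy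
  set p := Uhᵀ *ᵥ ((M * (1 - Vh * Vhᵀ)) *ᵥ y) with hp
  set q := W *ᵥ (Vhᵀ *ᵥ x) with hq
  set z := ((1 - Uh * Uhᵀ) * M) *ᵥ x with hz
  have hdec : (M - Uh * (Uhᵀ * M * Vh) * Vhᵀ + Uh * W * Vhᵀ) *ᵥ x = z + Uh *ᵥ (p + q) := by
    rw [hz, hp, hq, hy, mulVec_add]
    simp only [mulVec_mulVec, ← add_mulVec]
    congr 1
    rw [Matrix.mul_assoc M, hQQ]
    simp only [Matrix.mul_sub, Matrix.sub_mul, Matrix.one_mul, Matrix.mul_one, Matrix.mul_assoc]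
    abel
  have horth : Uhᵀ *ᵥ z = 0 := by
    rw [hz, mulVec_mulVec, ← Matrix.mul_assoc, hPU, Matrix.zero_mul, zero_mulVec]
  have hzU : z ⬝ᵥ Uh *ᵥ (p + q) = 0 := by
    rw [dotProduct_mulVec, ← mulVec_transpose, horth, zero_dotProduct]
  have hpb : p ⬝ᵥ p ≤ b * (y ⬝ᵥ y) := (bessel hU _).trans (hMb y)
  have hqb : q ⬝ᵥ q ≤ (∑ i, ∑ j, W i j ^ 2) * ((Vhᵀ *ᵥ x) ⬝ᵥ (Vhᵀ *ᵥ x)) := opSqLE_frobenius W _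
  have hpq := sum_dotProduct_le hb (by positivity) (dotProduct_self_nonneg _)
    (dotProduct_self_nonneg _) hpb hqb
  have hyx := dotProduct_self_sub_projection hV x
  rw [← hy] at hyx
  rw [hyx, sub_add_cancel] at hpq
  rw [hdec, add_dotProduct, dotProduct_add, dotProduct_add, dotProduct_comm (Uh *ᵥ (p + q)) z, hzU,
    isometry_dotProduct hU]
  have := hMa' x
  rw [← hz] at this
  linarith

lemma frobNorm_sq (X : Matrix (Fin n) (Fin m) ℝ) : frobNorm X ^ 2 = ∑ i, ∑ j, X i j ^ 2 := by
  rw [frobNorm, Matrix.frobenius_norm_def, ← Real.sqrt_eq_rpow, Real.sq_sqrt (by positivity)]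
  simp

lemma objective_eq (Om : Finset (Fin n × Fin m)) (Z : Matrix (Fin r) (Fin r) ℝ) :
    objective M Om Uh Vh Z = 1 / 2 * ∑ e ∈ Om, (M e.1 e.2 - (Uh * Z * Vhᵀ) e.1 e.2) ^ 2 := by
  rw [objective, frobNorm_sq, ← Fintype.sum_prod_type'
    (f := fun i j => (restrict Om M - restrict Om (Uh * Z * Vhᵀ)) i j ^ 2)]
  congr 1
  rw [← Finset.sum_filter_add_sum_filter_not Finset.univ (· ∈ Om), Finset.filter_mem_eq_inter,
    Finset.univ_inter, Finset.sum_eq_zero (s := Finset.univ.filter (· ∉ Om)), add_zero]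
  · refine Finset.sum_congr rfl fun e he => ?_
    simp [restrict, he]
  · intro e he
    have : e ∉ Om := (Finset.mem_filter.1 he).2
    simp [restrict, this]

/-- Least squares solutions are stable under projection of the data. -/
lemma sum_sq_minimizer_sub_le (Om : Finset (Fin n × Fin m)) {Z : Matrix (Fin r) (Fin r) ℝ}
    (hZ : ∀ Z', objective M Om Uh Vh Z ≤ objective M Om Uh Vh Z') (Z₀ : Matrix (Fin r) (Fin r) ℝ) :
    ∑ e ∈ Om, (Uh * (Z₀ - Z) * Vhᵀ) e.1 e.2 ^ 2 ≤
      ∑ e ∈ Om, (M - Uh * Z₀ * Vhᵀ) e.1 e.2 ^ 2 := by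
  set D := M - Uh * Z₀ * Vhᵀ with hD
  set X := Uh * (Z₀ - Z) * Vhᵀ with hX
  have hobj (s : ℝ) : objective M Om Uh Vh (Z + s • (Z₀ - Z)) =
      1 / 2 * (∑ e ∈ Om, D e.1 e.2 ^ 2 + 2 * (1 - s) * ∑ e ∈ Om, D e.1 e.2 * X e.1 e.2 +
        (1 - s) ^ 2 * ∑ e ∈ Om, X e.1 e.2 ^ 2) := by
    rw [objective_eq, Finset.mul_sum _ _ (2 * (1 - s)), Finset.mul_sum _ _ ((1 - s) ^ 2),
      ← Finset.sum_add_distrib, ← Finset.sum_add_distrib]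
    congr 1
    refine Finset.sum_congr rfl fun e _ => ?_
    have : M - Uh * (Z + s • (Z₀ - Z)) * Vhᵀ = D + (1 - s) • X := by
      rw [hD, hX]
      simp only [Matrix.mul_add, Matrix.add_mul, Matrix.mul_smul, Matrix.smul_mul, Matrix.mul_sub,
        Matrix.sub_mul]
      module
    have h2 := congrFun (congrFun this e.1) e.2
    rw [Matrix.sub_apply, Matrix.add_apply, Matrix.smul_apply, smul_eq_mul] at h2
    rw [h2]; ring
  have hmin (s : ℝ) := (hZ (Z + s • (Z₀ - Z)))
  have h0 := hobj 0
  rw [zero_smul, add_zero] at h0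
  simp only [h0, hobj] at hmin
  set A := ∑ e ∈ Om, X e.1 e.2 ^ 2
  set B := ∑ e ∈ Om, D e.1 e.2 * X e.1 e.2
  set C := ∑ e ∈ Om, D e.1 e.2 ^ 2
  have hA : 0 ≤ A := Finset.sum_nonneg fun _ _ => sq_nonneg _
  have hCS : B ^ 2 ≤ C * A := Finset.sum_mul_sq_le_sq_mul_sq Om _ _
  rcases hA.eq_or_lt with h | h
  · rw [← h]; exact Finset.sum_nonneg fun _ _ => sq_nonneg _
  · have hq (s : ℝ) : 0 ≤ -(2 * s) * B + (s ^ 2 - 2 * s) * A := by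
      have := hmin s; nlinarith
    -- The quadratic `hq` attains its minimum `-(A + B)² / A` at this `s`; being nonnegative, it
    -- forces the normal equation `B = -A`.
    have hBA : B = -A := by
      have h1 := hq ((A + B) / A)
      have h2 : -(2 * ((A + B) / A)) * B + (((A + B) / A) ^ 2 - 2 * ((A + B) / A)) * A =
          -((A + B) ^ 2 / A) := by field_simp; ring
      rw [h2] at h1
      have h3 : (A + B) ^ 2 / A = 0 := le_antisymm (by linarith) (by positivity)
      rcases div_eq_zero_iff.1 h3 with h4 | h4
      · nlinarith [pow_eq_zero_iff (two_ne_zero) |>.1 h4]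
      · exact absurd h4 h.ne'
    rw [hBA] at hCS
    nlinarith

/-- Compare with the projection `Z₀ = Uhᵀ M Vh`. Its residual has squared entries at most `a + b`,
so stability of least squares and conditioning of `Om` give `‖Z₀ - Z‖_F² ≤ L (a + b)`, which enters
the two-sided bound as `W`. -/
lemma opSqLE_estimate (hU : Uhᵀ * Uh = 1) (hV : Vhᵀ * Vh = 1) (ha : 0 ≤ a) (hb : 0 ≤ b)
    (hMa : OpSqLE (Mᵀ * (1 - Uh * Uhᵀ)) a) (hMb : OpSqLE (M * (1 - Vh * Vhᵀ)) b)
    {Om : Finset (Fin n × Fin m)} {c L : ℝ} (hc : 0 < c)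
    (hcL : (Om.card : ℝ) ≤ c * L)
    (hOm : ∀ W : Matrix (Fin r) (Fin r) ℝ,
      c * ∑ i, ∑ j, W i j ^ 2 ≤ ∑ e ∈ Om, (Uh * W * Vhᵀ) e.1 e.2 ^ 2)
    {Z : Matrix (Fin r) (Fin r) ℝ}
    (hZ : ∀ Z', objective M Om Uh Vh Z ≤ objective M Om Uh Vh Z') :
    OpSqLE (M - Uh * Z * Vhᵀ) ((1 + L) * (a + b)) := by
  set Z₀ := Uhᵀ * M * Vh with hZ₀
  have hD : OpSqLE (M - Uh * Z₀ * Vhᵀ) (a + b) := by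
    have := opSqLE_two_sided hU hV ha hb hMa hMb 0
    simpa using this
  have hent : ∑ e ∈ Om, (M - Uh * Z₀ * Vhᵀ) e.1 e.2 ^ 2 ≤ Om.card * (a + b) := by
    rw [← nsmul_eq_mul, ← Finset.sum_const]
    exact Finset.sum_le_sum fun e _ => hD.sq_entry_le e.1 e.2
  have hW : ∑ i, ∑ j, (Z₀ - Z) i j ^ 2 ≤ L * (a + b) := by
    refine le_of_mul_le_mul_left ?_ hc
    calc _ ≤ _ := hOm (Z₀ - Z)
      _ ≤ _ := sum_sq_minimizer_sub_le Om hZ Z₀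
      _ ≤ _ := hent
      _ ≤ c * L * (a + b) := mul_le_mul_of_nonneg_right hcL (add_nonneg ha hb)
      _ = _ := by ring
  have hfin := opSqLE_two_sided hU hV ha hb hMa hMb (Z₀ - Z)
  have e : M - Uh * Z₀ * Vhᵀ + Uh * (Z₀ - Z) * Vhᵀ = M - Uh * Z * Vhᵀ := by
    rw [Matrix.mul_sub, Matrix.sub_mul]; abel
  rw [← hZ₀, e] at hfin
  intro x
  refine (hfin x).trans (mul_le_mul_of_nonneg_right ?_ (dotProduct_self_nonneg x))
  linarith

end Assembly

end CURPlus

namespace CURPlus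

open Matrix

/-! ### Range approximation from sampled columns -/

section RangeApproximation

lemma orthonormal_firstCols {p q r : ℕ} (hr : r ≤ q) {W : Matrix (Fin p) (Fin q) ℝ}
    (hW : Wᵀ * W = 1) : (firstCols hr W)ᵀ * firstCols hr W = 1 := by
  rw [firstCols, transpose_submatrix,
    ← submatrix_mul Wᵀ W (Fin.castLE hr) id (Fin.castLE hr) Function.bijective_id, hW]
  exact submatrix_one _ (Fin.castLE_injective hr)

lemma IsTopEigenvectors.orthonormal {p r : ℕ} {hr : r ≤ p} {S : Matrix (Fin p) (Fin p) ℝ}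
    {U : Matrix (Fin p) (Fin r) ℝ} (h : IsTopEigenvectors hr S U) : Uᵀ * U = 1 := by
  obtain ⟨W, ev, hW, -, -, rfl⟩ := h
  exact orthonormal_firstCols hr hW

lemma sum_castLE {k r : ℕ} (hr : r ≤ k) (f : Fin k → ℝ) :
    ∑ i, (if i.val < r then f i else 0) = ∑ i : Fin r, f (Fin.castLE hr i) := by
  rw [← Finset.sum_filter]
  symm
  refine Finset.sum_bij (fun i _ => Fin.castLE hr i) (fun i _ => by simp)
    (fun i _ j _ h => Fin.castLE_injective hr h)
    (fun i hi => ⟨⟨i, (Finset.mem_filter.1 hi).2⟩, Finset.mem_univ _, rfl⟩) fun i _ => rfl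

lemma firstCols_mulVec {p k r : ℕ} (hr : r ≤ k) (W : Matrix (Fin p) (Fin k) ℝ) (g : Fin k → ℝ) :
    firstCols hr W *ᵥ (fun i => g (Fin.castLE hr i)) =
      W *ᵥ fun i => if i.val < r then g i else 0 := by
  ext i
  simp only [mulVec, dotProduct, firstCols, submatrix_apply, id]
  rw [← sum_castLE hr fun j => W i j * g j]
  exact Finset.sum_congr rfl fun j _ => by split_ifs <;> simp

variable {p q k r : ℕ} {M : Matrix (Fin p) (Fin q) ℝ} {U : Matrix (Fin p) (Fin k) ℝ}
  {V : Matrix (Fin q) (Fin k) ℝ} {s : Fin k → ℝ} {τ : ℝ}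

/-- The transpose of `M`, restricted to its singular directions from the `r`-th on. -/
lemma dotProduct_tail_le (hU : Uᵀ * U = 1) (hV : Vᵀ * V = 1) (hs : ∀ i, 0 ≤ s i)
    (hτ : ∀ i, r ≤ i.val → s i ≤ τ) (z : Fin p → ℝ) :
    (V *ᵥ fun i => if i.val < r then 0 else s i * (Uᵀ *ᵥ z) i) ⬝ᵥ
      (V *ᵥ fun i => if i.val < r then 0 else s i * (Uᵀ *ᵥ z) i) ≤ τ ^ 2 * (z ⬝ᵥ z) := by
  rw [isometry_dotProduct hV, dotProduct_self_eq_sum_sq]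
  refine le_trans ?_ (mul_le_mul_of_nonneg_left (bessel hU z) (sq_nonneg τ))
  rw [dotProduct_self_eq_sum_sq, Finset.mul_sum]
  refine Finset.sum_le_sum fun i _ => ?_
  split_ifs with h
  · rw [zero_pow two_ne_zero]; positivity
  · rw [mul_pow]
    exact mul_le_mul_of_nonneg_right (pow_le_pow_left₀ (hs i) (hτ i (not_lt.1 h)) 2) (sq_nonneg _)

lemma transpose_mulVec_svd (hM : M = U * diagonal s * Vᵀ) (hr : r ≤ k) (z : Fin p → ℝ) :
    Mᵀ *ᵥ z = firstCols hr V *ᵥ (fun i => s (Fin.castLE hr i) * (Uᵀ *ᵥ z) (Fin.castLE hr i)) +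
      V *ᵥ fun i => if i.val < r then 0 else s i * (Uᵀ *ᵥ z) i := by
  rw [firstCols_mulVec hr V (fun i => s i * (Uᵀ *ᵥ z) i), ← mulVec_add, hM, transpose_mul,
    transpose_mul, transpose_transpose, diagonal_transpose, ← mulVec_mulVec, ← mulVec_mulVec]
  congr 1
  ext i
  rw [mulVec_diagonal, Pi.add_apply]
  split_ifs <;> simp

lemma sampledCols_dotProduct (J : Finset (Fin q)) (z : Fin p → ℝ) :
    ((sampledCols M J)ᵀ *ᵥ z) ⬝ᵥ ((sampledCols M J)ᵀ *ᵥ z) = ∑ j ∈ J, (Mᵀ *ᵥ z) j ^ 2 := by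
  rw [dotProduct_self_eq_sum_sq, ← Finset.sum_coe_sort J fun j => (Mᵀ *ᵥ z) j ^ 2]
  rfl

lemma sampledCols_gram (J : Finset (Fin q)) (z : Fin p → ℝ) :
    z ⬝ᵥ (sampledCols M J * (sampledCols M J)ᵀ) *ᵥ z = ∑ j ∈ J, (Mᵀ *ᵥ z) j ^ 2 := by
  rw [← mulVec_mulVec, dotProduct_mulVec, ← mulVec_transpose, sampledCols_dotProduct]

lemma sum_subset_sq_le (J : Finset (Fin q)) (x : Fin q → ℝ) : ∑ j ∈ J, x j ^ 2 ≤ x ⬝ᵥ x := by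
  rw [dotProduct_self_eq_sum_sq]
  exact Finset.sum_le_sum_of_subset_of_nonneg (Finset.subset_univ J) fun _ _ _ => sq_nonneg _

lemma exists_mem_ker {r : ℕ} (X : Matrix (Fin r) (Fin (r + 1)) ℝ) :
    ∃ x, x ≠ 0 ∧ X *ᵥ x = 0 := by
  have h := LinearMap.ker_ne_bot_of_finrank_lt (f := X.mulVecLin) (by simp)
  obtain ⟨x, hx, hx0⟩ := Submodule.exists_mem_ne_zero_of_ne_bot h
  exact ⟨x, hx0, by simpa using hx⟩

lemma dotProduct_self_eq_sum_coords {W : Matrix (Fin p) (Fin p) ℝ} (hW : W * Wᵀ = 1)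
    (z : Fin p → ℝ) : z ⬝ᵥ z = ∑ j, (Wᵀ *ᵥ z) j ^ 2 := by
  rw [← dotProduct_self_eq_sum_sq,
    isometry_dotProduct (V := Wᵀ) (by rw [transpose_transpose, hW])]

/-- The eigenvalues of a sampled Gram matrix are bounded by those of the full one. -/
lemma sampled_eigenvalue_le (hU : Uᵀ * U = 1) (hV : Vᵀ * V = 1) (hM : M = U * diagonal s * Vᵀ)
    (hr : r ≤ k) (hs : ∀ i, 0 ≤ s i) (hτ : ∀ i, r ≤ i.val → s i ≤ τ) (J : Finset (Fin q))
    {W : Matrix (Fin p) (Fin p) ℝ} {ev : Fin p → ℝ} (hW : Wᵀ * W = 1) (hev : Antitone ev)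
    (hA : sampledCols M J * (sampledCols M J)ᵀ = W * diagonal ev * Wᵀ) {i : Fin p}
    (hi : r ≤ i.val) : ev i ≤ τ ^ 2 := by
  have hrp : r + 1 ≤ p := lt_of_le_of_lt hi i.isLt
  -- Courant–Fischer by dimension count: the span of the top `r + 1` eigenvectors contains a nonzero
  -- `w` orthogonal to the first `r` left singular vectors. Its Rayleigh quotient is at least `ev
  -- i`, as `i` counts from `0` and `r ≤ i`, and at most `τ ^ 2`.
  obtain ⟨x, hx0, hx⟩ := exists_mem_ker ((firstCols hr U)ᵀ * firstCols hrp W)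
  set w := firstCols hrp W *ᵥ x with hw
  have hww : w ⬝ᵥ w = x ⬝ᵥ x := isometry_dotProduct (orthonormal_firstCols hrp hW) x x
  have hxx : 0 < x ⬝ᵥ x := by
    refine (dotProduct_self_nonneg x).lt_of_ne fun h => hx0 ?_
    exact dotProduct_self_eq_zero.1 h.symm
  have hhead : ∀ j : Fin r, (Uᵀ *ᵥ w) (Fin.castLE hr j) = 0 := by
    intro j
    rw [← mulVec_mulVec, ← hw] at hx
    exact congrFun hx j
  have hupper : w ⬝ᵥ (sampledCols M J * (sampledCols M J)ᵀ) *ᵥ w ≤ τ ^ 2 * (w ⬝ᵥ w) := by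
    rw [sampledCols_gram]
    refine (sum_subset_sq_le J _).trans ?_
    rw [transpose_mulVec_svd hM hr]
    simp only [hhead, mul_zero]
    rw [show (fun _ : Fin r => (0 : ℝ)) = 0 from rfl, mulVec_zero, zero_add]
    exact dotProduct_tail_le hU hV hs hτ w
  have hWw : ∀ j : Fin p, ¬ j.val < r + 1 → (Wᵀ *ᵥ w) j = 0 := by
    intro j hj
    rw [hw, mulVec_mulVec]
    change ∑ l, (Wᵀ * firstCols hrp W) j l * x l = 0
    refine Finset.sum_eq_zero fun l _ => ?_
    have h1 := congrFun (congrFun hW j) (Fin.castLE hrp l)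
    have h2 : j ≠ Fin.castLE hrp l := by
      rintro rfl; exact hj l.isLt
    rw [one_apply_ne h2] at h1
    have h3 : (Wᵀ * firstCols hrp W) j l = 0 := h1
    rw [h3, zero_mul]
  have hWW : W * Wᵀ = 1 := mul_eq_one_comm.1 hW
  have hsum : w ⬝ᵥ w = ∑ j, (Wᵀ *ᵥ w) j ^ 2 := dotProduct_self_eq_sum_coords hWW w
  have hlower : ev i * (w ⬝ᵥ w) ≤ w ⬝ᵥ (sampledCols M J * (sampledCols M J)ᵀ) *ᵥ w := by
    rw [hA, quad_spectral, hsum, Finset.mul_sum]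
    refine Finset.sum_le_sum fun j _ => ?_
    by_cases hj : j.val < r + 1
    · exact mul_le_mul_of_nonneg_right (hev (Fin.le_def.2 (by omega))) (sq_nonneg _)
    · rw [hWw j hj]; simp
  rw [hww] at hlower hupper
  exact le_of_mul_le_mul_right (hlower.trans hupper) hxx

/-- The leading eigenvectors of a well-conditioned sample capture the range of the matrix. -/
lemma opSqLE_range_approximation (hU : Uᵀ * U = 1) (hV : Vᵀ * V = 1)
    (hM : M = U * diagonal s * Vᵀ) (hr : r ≤ k) (hrp : r ≤ p) (hs : ∀ i, 0 ≤ s i)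
    (hτ : ∀ i, r ≤ i.val → s i ≤ τ) {J : Finset (Fin q)} {c : ℝ} (hc : 0 < c)
    (hJ : ∀ x : Fin r → ℝ, c * (x ⬝ᵥ x) ≤ ∑ j ∈ J, (firstCols hr V j ⬝ᵥ x) ^ 2)
    {Uh : Matrix (Fin p) (Fin r) ℝ}
    (hUh : IsTopEigenvectors hrp (sampledCols M J * (sampledCols M J)ᵀ) Uh) :
    OpSqLE (Mᵀ * (1 - Uh * Uhᵀ)) (τ ^ 2 * (1 + 4 / c)) := by
  intro y
  have hUU := hUh.orthonormal
  obtain ⟨W, ev, hW, hev, hSW, hUW⟩ := hUh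
  have hWW : W * Wᵀ = 1 := mul_eq_one_comm.1 hW
  have hA : sampledCols M J * (sampledCols M J)ᵀ = W * diagonal ev * Wᵀ := by
    rw [← hSW, Matrix.mul_assoc, hWW, Matrix.mul_one]
  rw [← mulVec_mulVec]
  set z := (1 - Uh * Uhᵀ) *ᵥ y with hz
  have hzy : z ⬝ᵥ z ≤ y ⬝ᵥ y := by
    have := dotProduct_self_sub_projection hUU y
    have h0 := dotProduct_self_nonneg (Uhᵀ *ᵥ y)
    rw [← hz] at this
    linarith
  have hzhead : Uhᵀ *ᵥ z = 0 := by
    rw [hz, mulVec_mulVec, Matrix.mul_sub, ← Matrix.mul_assoc, hUU]; simp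
  have hzW : ∀ i : Fin p, i.val < r → (Wᵀ *ᵥ z) i = 0 := by
    intro i hi
    rw [hUW] at hzhead
    exact congrFun hzhead ⟨i, hi⟩
  have hsum : z ⬝ᵥ z = ∑ j, (Wᵀ *ᵥ z) j ^ 2 := dotProduct_self_eq_sum_coords hWW z
  have hsample : ∑ j ∈ J, (Mᵀ *ᵥ z) j ^ 2 ≤ τ ^ 2 * (z ⬝ᵥ z) := by
    rw [← sampledCols_gram, hA, quad_spectral, hsum, Finset.mul_sum]
    refine Finset.sum_le_sum fun i _ => ?_
    by_cases hi : i.val < r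
    · rw [hzW i hi]; simp
    · exact mul_le_mul_of_nonneg_right
        (sampled_eigenvalue_le hU hV hM hr hs hτ J hW hev hA (not_lt.1 hi)) (sq_nonneg _)
  set h : Fin r → ℝ := fun i => s (Fin.castLE hr i) * (Uᵀ *ᵥ z) (Fin.castLE hr i) with hh
  set g : Fin k → ℝ := fun i => if i.val < r then 0 else s i * (Uᵀ *ᵥ z) i with hg
  have hdec : Mᵀ *ᵥ z = firstCols hr V *ᵥ h + V *ᵥ g := transpose_mulVec_svd hM hr z
  have htail : (V *ᵥ g) ⬝ᵥ (V *ᵥ g) ≤ τ ^ 2 * (z ⬝ᵥ z) := dotProduct_tail_le hU hV hs hτ z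
  -- On the sampled coordinates the head is `Mᵀ z` minus the tail, and each has squared norm at most
  -- `τ ^ 2 |z|²`; `(x - y)² ≤ 2x² + 2y²` yields the `4`. Conditioning of `J` carries this bound to
  -- the whole head.
  have hhead : c * (h ⬝ᵥ h) ≤ 4 * (τ ^ 2 * (z ⬝ᵥ z)) := by
    refine (hJ h).trans ?_
    have : ∀ j ∈ J, (firstCols hr V j ⬝ᵥ h) ^ 2 ≤
        2 * (Mᵀ *ᵥ z) j ^ 2 + 2 * (V *ᵥ g) j ^ 2 := by
      intro j _
      have h1 : (Mᵀ *ᵥ z) j = firstCols hr V j ⬝ᵥ h + (V *ᵥ g) j := congrFun hdec j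
      rw [h1]
      nlinarith [sq_nonneg (firstCols hr V j ⬝ᵥ h + 2 * (V *ᵥ g) j)]
    refine (Finset.sum_le_sum this).trans ?_
    rw [Finset.sum_add_distrib, ← Finset.mul_sum, ← Finset.mul_sum]
    have := (sum_subset_sq_le J (V *ᵥ g)).trans htail
    linarith
  have horth : (firstCols hr V *ᵥ h) ⬝ᵥ (V *ᵥ g) = 0 := by
    rw [hh, firstCols_mulVec hr V fun i => s i * (Uᵀ *ᵥ z) i, isometry_dotProduct hV]
    refine Finset.sum_eq_zero fun i _ => ?_
    rw [hg]
    dsimp only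
    split_ifs <;> simp
  have hhh : h ⬝ᵥ h ≤ 4 / c * (τ ^ 2 * (z ⬝ᵥ z)) := by
    rw [div_mul_eq_mul_div, le_div_iff₀ hc]; linarith
  rw [hdec, add_dotProduct, dotProduct_add, dotProduct_add,
    dotProduct_comm (V *ᵥ g) (firstCols hr V *ᵥ h), horth,
    isometry_dotProduct (orthonormal_firstCols hr hV)]
  calc h ⬝ᵥ h + 0 + (0 + (V *ᵥ g) ⬝ᵥ (V *ᵥ g)) ≤ τ ^ 2 * (1 + 4 / c) * (z ⬝ᵥ z) := by
        linarith
    _ ≤ _ := mul_le_mul_of_nonneg_left hzy (by positivity)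

end RangeApproximation

end CURPlus

namespace CURPlus

open Matrix

/-! ### From counting to probability -/

section Sampling

open scoped ENNReal

/-- Lets the three sampling stages be treated one after another, each with the earlier outcomes
fixed. -/
lemma le_toOuterMeasure_bind {α β : Type*} (p : PMF α) (f : α → PMF β) {G : Set α} {S : Set β}
    {a b : ℝ≥0∞} (hG : a ≤ p.toOuterMeasure G) (hS : ∀ x ∈ G, b ≤ (f x).toOuterMeasure S) :
    a * b ≤ (p.bind f).toOuterMeasure S := by
  refine (mul_le_mul_left hG b).trans ?_
  rw [PMF.toOuterMeasure_bind_apply, PMF.toOuterMeasure_apply, ← ENNReal.tsum_mul_right]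
  refine ENNReal.tsum_le_tsum fun x => ?_
  by_cases hx : x ∈ G
  · rw [Set.indicator_of_mem hx]
    exact mul_le_mul_right (hS x hx) _
  · rw [Set.indicator_of_notMem hx, zero_mul]
    exact zero_le

lemma le_toOuterMeasure_uniformSubset {α : Type} [Fintype α] {d : ℕ} (hd : d ≤ Fintype.card α)
    {ε : ℝ} {P : Finset α → Prop}
    (hP : ∀ B : Finset (Finset α), (∀ J ∈ B, J.card = d ∧ ¬ P J) →
      (B.card : ℝ) ≤ ε * (Fintype.card α).choose d) :
    ENNReal.ofReal (1 - ε) ≤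
      (uniformSubset α d hd).toOuterMeasure {J | J.card = d ∧ P J} := by
  classical
  rw [uniformSubset, PMF.toOuterMeasure_uniformOfFinset_apply]
  set S := Finset.powersetCard d (Finset.univ : Finset α) with hS
  have hScard : S.card = (Fintype.card α).choose d := by
    rw [hS, Finset.card_powersetCard, Finset.card_univ]
  have hSpos : 0 < S.card := by rw [hScard]; exact Nat.choose_pos hd
  have hSR : (0 : ℝ) < S.card := by exact_mod_cast hSpos
  have hmem (J : Finset α) (hJ : J ∈ S) : J.card = d := (Finset.mem_powersetCard.1 hJ).2
  have hB := hP (S.filter fun J => ¬ P J) fun J hJ =>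
    ⟨hmem J (Finset.mem_filter.1 hJ).1, (Finset.mem_filter.1 hJ).2⟩
  rw [← hScard] at hB
  have hsplit := Finset.card_filter_add_card_filter_not (s := S) P
  have hgood : (S.filter fun J => J ∈ {J : Finset α | J.card = d ∧ P J}) = S.filter P :=
    Finset.filter_congr fun J hJ => by simp [hmem J hJ]
  have hreal : 1 - ε ≤ ((S.filter P).card : ℝ) / S.card := by
    rw [le_div_iff₀ hSR]
    have : ((S.filter P).card : ℝ) + ((S.filter fun J => ¬ P J).card : ℝ) = S.card := by
      exact_mod_cast hsplit
    linarith
  calc ENNReal.ofReal (1 - ε) ≤ ENNReal.ofReal (((S.filter P).card : ℝ) / S.card) :=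
        ENNReal.ofReal_le_ofReal hreal
    _ = ((S.filter P).card : ℝ≥0∞) / S.card := by
        rw [ENNReal.ofReal_div_of_pos hSR, ENNReal.ofReal_natCast, ENNReal.ofReal_natCast]
    _ ≤ _ := by
        refine le_of_eq ?_
        congr 2
        convert (congrArg Finset.card hgood).symm

lemma le_toOuterMeasure_wellConditioned {α ι : Type} [Fintype α] [Nonempty α] [Fintype ι]
    [DecidableEq ι] [Nonempty ι] {v : α → ι → ℝ} (hv : ∑ a, vecMulVec (v a) (v a) = 1)
    {K t : ℝ} (hK : 0 < K) (ht : 0 ≤ t) (hvK : ∀ a, v a ⬝ᵥ v a ≤ K / Fintype.card α) {d : ℕ}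
    (hd : 7 * K * (t + Real.log (Fintype.card ι)) ≤ d) (hdα : d ≤ Fintype.card α) :
    ENNReal.ofReal (1 - Real.exp (-t)) ≤ (uniformSubset α d hdα).toOuterMeasure
      {J | J.card = d ∧
        ∀ x, d / (2 * Fintype.card α) * (x ⬝ᵥ x) ≤ ∑ j ∈ J, (v j ⬝ᵥ x) ^ 2} := by
  classical
  refine le_toOuterMeasure_uniformSubset hdα fun B hB => ?_
  refine card_ill_conditioned_le hv hK ht hvK hd fun J hJ => ⟨(hB J hJ).1, ?_⟩
  have := (hB J hJ).2
  push Not at this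
  exact this

end Sampling

/-! ### Incoherence and decompositions of the identity -/

section Incoherence

variable {n m r : ℕ} {X : Matrix (Fin n) (Fin r) ℝ} {Y : Matrix (Fin m) (Fin r) ℝ}

lemma sum_vecMulVec_rows (hX : Xᵀ * X = 1) : ∑ i, vecMulVec (X i) (X i) = 1 := by
  rw [← hX]
  ext k l
  rw [Matrix.sum_apply, Matrix.mul_apply]
  rfl

lemma row_left_le_incoherence (hr : 1 ≤ r) (i : Fin n) :
    X i ⬝ᵥ X i ≤ incoherence X Y * r / n := by
  have hn : (0 : ℝ) < n := by exact_mod_cast i.pos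
  have hr' : (0 : ℝ) < r := by exact_mod_cast hr
  have h : (n : ℝ) / r * ∑ k, X i k ^ 2 ≤ incoherence X Y :=
    (le_ciSup (f := fun i => (n : ℝ) / r * ∑ k, X i k ^ 2) (Set.finite_range _).bddAbove i).trans
      (le_max_left _ _)
  rw [dotProduct_self_eq_sum_sq, le_div_iff₀ hn]
  rw [div_mul_eq_mul_div, div_le_iff₀ hr'] at h
  linarith

lemma incoherence_comm : incoherence X Y = incoherence Y X := max_comm _ _

lemma row_right_le_incoherence (hr : 1 ≤ r) (j : Fin m) :
    Y j ⬝ᵥ Y j ≤ incoherence X Y * r / m := by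
  rw [incoherence_comm]; exact row_left_le_incoherence hr j

lemma incoherence_pos (hr : 1 ≤ r) (hX : Xᵀ * X = 1) : 0 < incoherence X Y := by
  have hr' : (0 : ℝ) < r := by exact_mod_cast hr
  have h1 := congrFun (congrFun hX ⟨0, hr⟩) ⟨0, hr⟩
  rw [one_apply_eq, Matrix.mul_apply] at h1
  obtain ⟨i, -, hi⟩ := Finset.exists_ne_zero_of_sum_ne_zero (h1.trans_ne one_ne_zero)
  have hi' : X i ≠ 0 := fun h => hi (by simp [h])
  have hn : (0 : ℝ) < n := by exact_mod_cast i.pos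
  have hpos : 0 < X i ⬝ᵥ X i :=
    (dotProduct_self_nonneg _).lt_of_ne fun h => hi' (dotProduct_self_eq_zero.1 h.symm)
  have h2 := hpos.trans_le (row_left_le_incoherence (Y := Y) hr i)
  by_contra hc
  push Not at hc
  exact absurd h2 (not_lt.2 (div_nonpos_of_nonpos_of_nonneg
    (mul_nonpos_of_nonpos_of_nonneg hc hr'.le) hn.le))

/-- The vector `uᵢ ⊗ vⱼ` of coefficients of the entry `(i, j)` of `X Z Yᵀ` in the entries of `Z`. -/
def tensorRow (X : Matrix (Fin n) (Fin r) ℝ) (Y : Matrix (Fin m) (Fin r) ℝ) (e : Fin n × Fin m) :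
    Fin r × Fin r → ℝ :=
  fun k => X e.1 k.1 * Y e.2 k.2

lemma tensorRow_dotProduct (Z : Matrix (Fin r) (Fin r) ℝ) (e : Fin n × Fin m) :
    tensorRow X Y e ⬝ᵥ (fun k => Z k.1 k.2) = (X * Z * Yᵀ) e.1 e.2 := by
  rw [Matrix.mul_apply, dotProduct, Fintype.sum_prod_type, Finset.sum_comm]
  refine Finset.sum_congr rfl fun l _ => ?_
  rw [Matrix.mul_apply, Finset.sum_mul]
  refine Finset.sum_congr rfl fun k _ => ?_
  rw [tensorRow, transpose_apply]; ring

lemma tensorRow_dotProduct_self (e : Fin n × Fin m) :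
    tensorRow X Y e ⬝ᵥ tensorRow X Y e = (X e.1 ⬝ᵥ X e.1) * (Y e.2 ⬝ᵥ Y e.2) := by
  rw [dotProduct, dotProduct, dotProduct, Finset.sum_mul_sum, Fintype.sum_prod_type]
  refine Finset.sum_congr rfl fun k _ => Finset.sum_congr rfl fun l _ => ?_
  rw [tensorRow]; ring

/-- The Kronecker product of the two row decompositions. It casts entry sampling as subset sampling
in dimension `r²`. -/
lemma sum_vecMulVec_tensorRow (hX : Xᵀ * X = 1) (hY : Yᵀ * Y = 1) :
    ∑ e, vecMulVec (tensorRow X Y e) (tensorRow X Y e) = 1 := by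
  ext ⟨k, l⟩ ⟨k', l'⟩
  have hx := congrFun (congrFun hX k) k'
  have hy := congrFun (congrFun hY l) l'
  rw [Matrix.mul_apply] at hx hy
  have h1 : (1 : Matrix (Fin r × Fin r) (Fin r × Fin r) ℝ) (k, l) (k', l') =
      (1 : Matrix (Fin r) (Fin r) ℝ) k k' * (1 : Matrix (Fin r) (Fin r) ℝ) l l' := by
    simp only [one_apply, Prod.mk.injEq]
    split_ifs <;> simp_all
  rw [h1, ← hx, ← hy, Finset.sum_mul_sum, Matrix.sum_apply, Fintype.sum_prod_type]
  refine Finset.sum_congr rfl fun i _ => Finset.sum_congr rfl fun j _ => ?_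
  simp only [vecMulVec_apply, tensorRow, transpose_apply]
  ring

end Incoherence

/-! ### The error bound and its probability -/

section Main

variable {n m r d : ℕ} {M : Matrix (Fin n) (Fin m) ℝ} {U : Matrix (Fin n) (Fin m) ℝ}
  {V : Matrix (Fin m) (Fin m) ℝ}

lemma sigma_nonneg (M : Matrix (Fin n) (Fin m) ℝ) (i : ℕ) : 0 ≤ sigma M i :=
  LinearMap.singularValues_nonneg _ _

lemma sigma_antitone (M : Matrix (Fin n) (Fin m) ℝ) {i j : ℕ} (h : i ≤ j) :
    sigma M (j + 1) ≤ sigma M (i + 1) :=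
  LinearMap.singularValues_antitone _ (by simpa using h)

lemma spectralNorm_sub_estimate_le (hmn : m ≤ n) (hrm : r ≤ m) (hm : 0 < m) (hd : 0 < d)
    (hSVD : IsSVD M U V) {J : Finset (Fin m)} {I : Finset (Fin n)}
    {Om : Finset (Fin n × Fin m)} {Uh : Matrix (Fin n) (Fin r) ℝ} {Vh : Matrix (Fin m) (Fin r) ℝ}
    (hUh : IsTopEigenvectors (hrm.trans hmn) (sampledCols M J * (sampledCols M J)ᵀ) Uh)
    (hVh : IsTopEigenvectors hrm (sampledRows M I * (sampledRows M I)ᵀ) Vh)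
    (hJ : ∀ x, (d : ℝ) / (2 * m) * (x ⬝ᵥ x) ≤ ∑ j ∈ J, (firstCols hrm V j ⬝ᵥ x) ^ 2)
    (hI : ∀ x, (d : ℝ) / (2 * n) * (x ⬝ᵥ x) ≤ ∑ i ∈ I, (firstCols hrm U i ⬝ᵥ x) ^ 2)
    (hOm0 : 0 < Om.card)
    (hOm : ∀ x, (Om.card : ℝ) / (2 * (n * m)) * (x ⬝ᵥ x) ≤ ∑ e ∈ Om, (tensorRow Uh Vh e ⬝ᵥ x) ^ 2)
    {Mh : Matrix (Fin n) (Fin m) ℝ} (hMh : IsCUREstimate M Om Uh Vh Mh) :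
    spectralNorm (M - Mh) ^ 2 ≤
      8 * sigma M (r + 1) ^ 2 * (1 + 2 * m * n) * (1 + ((m : ℝ) + n) / d) := by
  obtain ⟨hU, hV, hM⟩ := hSVD
  obtain ⟨Z, hZ, rfl⟩ := hMh
  have hm' : (0 : ℝ) < m := by exact_mod_cast hm
  have hn' : (0 : ℝ) < n := by exact_mod_cast hm.trans_le hmn
  have hd' : (0 : ℝ) < d := by exact_mod_cast hd
  have hO' : (0 : ℝ) < Om.card := by exact_mod_cast hOm0
  have hMT : Mᵀ = V * diagonal (fun i : Fin m => sigma M (i.val + 1)) * Uᵀ := by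
    conv_lhs => rw [hM]
    rw [transpose_mul, transpose_mul, transpose_transpose, diagonal_transpose, Matrix.mul_assoc]
  have hs : ∀ i : Fin m, 0 ≤ sigma M (i.val + 1) := fun i => sigma_nonneg M _
  have hτ : ∀ i : Fin m, r ≤ i.val → sigma M (i.val + 1) ≤ sigma M (r + 1) :=
    fun i hi => sigma_antitone M hi
  have hA := opSqLE_range_approximation hU hV hM hrm (hrm.trans hmn) hs hτ
    (c := (d : ℝ) / (2 * m)) (by positivity) hJ hUh
  -- Sampling rows of `M` is sampling columns of `Mᵀ`, so the same lemma applies with `U` and `V`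
  -- exchanged.
  have hB := opSqLE_range_approximation (M := Mᵀ) hV hU hMT hrm hrm hs hτ
    (c := (d : ℝ) / (2 * n)) (by positivity) hI hVh
  rw [transpose_transpose] at hB
  have hc : 0 < (Om.card : ℝ) / (2 * (n * m)) := div_pos hO' (by positivity)
  have hcL : (Om.card : ℝ) ≤ (Om.card : ℝ) / (2 * (n * m)) * (2 * m * n) := by
    rw [div_mul_eq_mul_div, le_div_iff₀ (by positivity)]
    exact le_of_eq (by ring)
  have hfin := opSqLE_estimate hUh.orthonormal hVh.orthonormal (by positivity) (by positivity)
    hA hB (Om := Om) (c := (Om.card : ℝ) / (2 * (n * m))) (L := 2 * m * n) hc hcL (fun W => by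
      have h := hOm fun k => W k.1 k.2
      simp only [tensorRow_dotProduct] at h
      rwa [dotProduct_self_eq_sum_sq, Fintype.sum_prod_type] at h) hZ
  refine (spectralNorm_sq_le (by positivity) hfin).trans ?_
  -- `4 / c` equals `8m/d` and `8n/d` on the two sides; the sum `2 + 8 (m + n)/d` is then relaxed to
  -- `8 (1 + (m + n)/d)`.
  have e : (1 + 2 * (m : ℝ) * n) * (sigma M (r + 1) ^ 2 * (1 + 4 / ((d : ℝ) / (2 * m))) +
      sigma M (r + 1) ^ 2 * (1 + 4 / ((d : ℝ) / (2 * n)))) =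
      sigma M (r + 1) ^ 2 * (1 + 2 * m * n) * (2 + 8 * (((m : ℝ) + n) / d)) := by
    field_simp; ring
  rw [e]
  have h : 0 ≤ sigma M (r + 1) ^ 2 * (1 + 2 * (m : ℝ) * n) := by positivity
  nlinarith

end Main

end CURPlus

open CURPlus Matrix in
theorem theorem2 {n m r d : ℕ} (hmn : m ≤ n) (hr : 1 ≤ r) (hrm : r ≤ m) (hdm : d ≤ m) (t : ℝ)
    (M : Matrix (Fin n) (Fin m) ℝ)
    -- a singular value decomposition of `M`
    (U : Matrix (Fin n) (Fin m) ℝ) (V : Matrix (Fin m) (Fin m) ℝ) (hSVD : IsSVD M U V)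
    -- first `r` eigenvectors of `A Aᵀ` and `B Bᵀ`, for every sample of columns and of rows
    (Uh : Finset (Fin m) → Matrix (Fin n) (Fin r) ℝ)
    (Vh : Finset (Fin n) → Matrix (Fin m) (Fin r) ℝ)
    (hUh : ∀ J, J.card = d →
      IsTopEigenvectors (hrm.trans hmn) (sampledCols M J * (sampledCols M J)ᵀ) (Uh J))
    (hVh : ∀ I, I.card = d →
      IsTopEigenvectors hrm (sampledRows M I * (sampledRows M I)ᵀ) (Vh I))
    -- the number of observed entries, which may be chosen after the columns and rows are sampled
    (N : Finset (Fin m) → Finset (Fin n) → ℕ) (hN : ∀ J I, N J I ≤ n * m)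
    (hd : 7 * incoherence (firstCols hrm U) (firstCols hrm V) * r * (t + Real.log r) ≤ (d : ℝ)) :
    ENNReal.ofReal (1 - 3 * Real.exp (-t)) ≤
      (sampling hdm (hdm.trans hmn) N hN).toOuterMeasure
        {ω | match ω with
          | (J, I, Om) =>
            7 * incoherence (Uh J) (Vh I) ^ 2 * (r : ℝ) ^ 2 * (t + 2 * Real.log r) ≤ (Om.card : ℝ) →
              ∀ Mh, IsCUREstimate M Om (Uh J) (Vh I) Mh →
                spectralNorm (M - Mh) ^ 2 ≤
                  8 * sigma M (r + 1) ^ 2 * (1 + 2 * m * n) * (1 + ((m : ℝ) + n) / d)} := by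
  -- For `t ≤ 0` the claimed probability is negative.
  rcases le_or_gt t 0 with ht | ht
  · have : 1 ≤ Real.exp (-t) := Real.one_le_exp (by linarith)
    rw [ENNReal.ofReal_of_nonpos (by linarith)]
    exact zero_le
  have hm : 0 < m := hr.trans hrm
  have hn : 0 < n := hm.trans_le hmn
  have hr' : (1 : ℝ) ≤ r := by exact_mod_cast hr
  have hm' : (0 : ℝ) < m := by exact_mod_cast hm
  have hn' : (0 : ℝ) < n := by exact_mod_cast hn
  have hlog : 0 ≤ Real.log r := Real.log_nonneg hr'
  have hm_ne : Nonempty (Fin m) := ⟨⟨0, hm⟩⟩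
  have hn_ne : Nonempty (Fin n) := ⟨⟨0, hn⟩⟩
  have hr_ne : Nonempty (Fin r) := ⟨⟨0, hr⟩⟩
  have hU1 := orthonormal_firstCols hrm hSVD.1
  have hV1 := orthonormal_firstCols hrm hSVD.2.1
  have hμ : 0 < incoherence (firstCols hrm U) (firstCols hrm V) := incoherence_pos hr hU1
  have hK : 0 < incoherence (firstCols hrm U) (firstCols hrm V) * r := by positivity
  have hdpos : 0 < d := by
    have : (0 : ℝ) < d := lt_of_lt_of_le (by positivity) hd
    exact_mod_cast this
  have hε : Real.exp (-t) ≤ 1 := Real.exp_le_one_iff.2 (by linarith)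
  have hε0 := Real.exp_nonneg (-t)
  -- `(1 - ε)³ ≥ 1 - 3ε` for `0 ≤ ε ≤ 1`, one factor per sampling stage.
  have hcube : ENNReal.ofReal (1 - 3 * Real.exp (-t)) ≤ ENNReal.ofReal (1 - Real.exp (-t)) *
      (ENNReal.ofReal (1 - Real.exp (-t)) * ENNReal.ofReal (1 - Real.exp (-t))) := by
    rw [← ENNReal.ofReal_mul (by linarith), ← ENNReal.ofReal_mul (by linarith)]
    refine ENNReal.ofReal_le_ofReal ?_
    nlinarith [mul_nonneg (sq_nonneg (Real.exp (-t))) (by linarith : 0 ≤ 3 - Real.exp (-t))]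
  refine hcube.trans (le_toOuterMeasure_bind _ _
    (le_toOuterMeasure_wellConditioned (sum_vecMulVec_rows hV1) hK ht.le
      (fun j => by rw [Fintype.card_fin]; exact row_right_le_incoherence hr j)
      (by rw [Fintype.card_fin, ← mul_assoc]; exact hd) _) ?_)
  rintro J ⟨hJd, hJ⟩
  refine le_toOuterMeasure_bind _ _
    (le_toOuterMeasure_wellConditioned (sum_vecMulVec_rows hU1) hK ht.le
      (fun i => by rw [Fintype.card_fin]; exact row_left_le_incoherence hr i)
      (by rw [Fintype.card_fin, ← mul_assoc]; exact hd) _) ?_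
  rintro I ⟨hId, hI⟩
  rw [Fintype.card_fin] at hJ hI
  rw [PMF.toOuterMeasure_map_apply]
  have hUJ := (hUh J hJd).orthonormal
  have hVI := (hVh I hId).orthonormal
  have hμh : 0 < incoherence (Uh J) (Vh I) := incoherence_pos hr hUJ
  set μ := incoherence (Uh J) (Vh I) with hμd
  have hcard : (Fintype.card (Fin n × Fin m) : ℝ) = n * m := by simp
  -- With `J` and `I` fixed, `N J I` is a number. If it is too small, the event is a vacuous
  -- implication on the whole support.
  by_cases hNJ : 7 * μ ^ 2 * (r : ℝ) ^ 2 * (t + 2 * Real.log r) ≤ (N J I : ℝ)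
  · have hNpos : 0 < N J I := by
      have : (0 : ℝ) < N J I := lt_of_lt_of_le (by positivity) hNJ
      exact_mod_cast this
    refine (le_toOuterMeasure_wellConditioned (sum_vecMulVec_tensorRow hUJ hVI)
      (K := μ ^ 2 * (r : ℝ) ^ 2) (by positivity) ht.le (fun e => ?_) ?_ _).trans
      (MeasureTheory.measure_mono ?_)
    · rw [tensorRow_dotProduct_self, hcard]
      calc _ ≤ (μ * r / n) * (μ * r / m) :=
            mul_le_mul (row_left_le_incoherence hr e.1) (row_right_le_incoherence hr e.2)
              (dotProduct_self_nonneg _) (by positivity)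
        _ = _ := by field_simp
    · have : Real.log (Fintype.card (Fin r × Fin r) : ℝ) = 2 * Real.log r := by
        rw [Fintype.card_prod, Fintype.card_fin, Nat.cast_mul,
          Real.log_mul (by positivity) (by positivity)]
        ring
      rw [this, ← mul_assoc]
      exact hNJ
    · rintro Om ⟨hOmc, hOm⟩ _ Mh hMh
      rw [hcard, ← hOmc] at hOm
      exact spectralNorm_sub_estimate_le hmn hrm hm hdpos hSVD (hUh J hJd) (hVh I hId) hJ hI
        (hOmc ▸ hNpos) hOm hMh
  · refine le_of_le_of_eq (ENNReal.ofReal_le_one.2 (by linarith)) (Eq.symm ?_)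
    rw [PMF.toOuterMeasure_apply_eq_one_iff]
    intro Om hOm
    rw [uniformSubset, PMF.mem_support_uniformOfFinset_iff, Finset.mem_powersetCard] at hOm
    intro h
    rw [hOm.2] at h
    exact absurd h hNJ
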